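/- **Conventions.** Let $-1<q<1$, $[n]_q=\sum_{i=0}^{n-1}q^i$ and $[n]_q!=\prod_{i=1}^n[i]_q$ (so $[0]_q!=1$). *Polynomials.* Let $x_1,x_2,\dots$ be non-commuting indeterminates over $\mathbb R$ and let $(r_k)_{k\ge1}$ be real numbers. For a finite sequence $u=(u(1),\dots,u(n))$ of positive integers the $q$-Kailath–Segall polynomial $A_u$ is defined recursively by $A_\emptyset=1$ and $$A_{(j,u)}=x_jA_u-\sum_{i=1}^n q^{i-1}r_{j+u(i)}A_{u\setminus u(i)}-\sum_{i=1}^n q^{i-1}A_{(j+u(i),\,u\setminus u(i))},$$ where $u\setminus u(i)$ is $u$ with its $i$-th entry removed (so $A_{(j)}=x_j$). Put $A^{(n)}=A_{(1,\dots,1)}$ ($n$ ones). *The process.* Let $\nu$ be a probability measure on $\mathbb R$ with compact support and $H=L^2(\mathbb R_+,dt)\otimes L^2(\mathbb R,\nu)=L^2(\mathbb R_+\times\mathbb R,\,dt\otimes\nu)$ (complex). On the algebraic Fock space $\bigoplus_{n\ge0}H^{\otimes n}$ with vacuum vector $\Omega$, the $q$-inner product is $$\langle\xi_1\otimes\dots\otimes\xi_n,\eta_1\otimes\dots\otimes\eta_m\rangle_q=\delta_{nm}\sum_{\sigma\in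 S_n}q^{i(\sigma)}\prod_{i=1}^n\langle\xi_i,\eta_{\sigma(i)}\rangle,$$ with $i(\sigma)$ the number of inversions of $\sigma$. For $\zeta\in H$ and a bounded operator $T$ on $H$ let $a^*(\zeta)\vec\eta=\zeta\otimes\vec\eta$, and let $$a(\zeta)(\eta_1\otimes\dots\otimes\eta_n)=\sum_{k=1}^nq^{k-1}\langle\zeta,\eta_k\rangle\,\eta_1\otimes\dots\check\eta_k\dots\otimes\eta_n,\qquad p(T)(\eta_1\otimes\dots\otimes\eta_n)=\sum_{k=1}^nq^{k-1}(T\eta_k)\otimes\eta_1\otimes\dots\check\eta_k\dots\otimes\eta_n$$ ($\check\eta_k$ means that $\eta_k$ is omitted), with $a(\zeta)\Omega=p(T)\Omega=0$. For $k\ge1$ and $I=[a,b)\subset\mathbb R_+$ let $Y_k(I)=a(\zeta)+a^*(\zeta)+p(T)$ with $\zeta=\chi_I\otimes x^{k-1}$ and $T$ the multiplication by $\chi_I\otimes x^k$; let $X(I)=Y_1(I)$. Let $\mathcal A_{X,\Delta}$ be the complex unital algebra generated by all $Y_k(I)$, and $\|A\|_\varphi=\langle A\Omega,A\Omega\rangle_q^{1/2}$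 the norm of $L^2(\varphi)$ for the vacuum state $\varphi$. For $t\ge0$: * $\Delta_k(t)$, $k\ge1$ (the diagonal measure), is the limit in $L^2(\varphi)$ of $\sum_iX(I_i)^k$ over subdivisions of $[0,t)$ into intervals $I_i=[s_{i-1},s_i)$, as $\max_i|I_i|\to0$; * $\psi_n(t)$ (the full stochastic measure) is the multiple stochastic integral $\int\chi_{[0,t)^n}\,dX(t_1)\cdots dX(t_n)$, where for pairwise disjoint intervals $\int\chi_{I_1\times\dots\times I_n}\,dX\cdots dX=X(I_1)\cdots X(I_n)$, extended linearly and then continuously from $L^2(\mathbb R_+^n)$ to $L^2(\varphi)$. **Proposition (Kailath–Segall formulas).** 1. For every sequence $(r_k)$, all $j\ge1$ and $n\ge0$ (with $n$ ones after $j$), $$A_{(j,1,\dots,1)}=x_jA^{(n)}+\sum_{k=1}^n(-1)^k\frac{[n]_q!}{[n-k]_q!}\,(x_{j+k}+r_{j+k})\,A^{(n-k)}.$$ 2. If $r_1=0$, then for all $n\ge0$ $$A^{(n+1)}=\sum_{k=0}^n(-1)^k\frac{[n]_q!}{[n-k]_q!}\,(x_{k+1}+r_{k+1})\,A^{(n-k)}.$$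 3. For every $\nu$ as above and every $t\ge0$, each $\Delta_k(t)$ ($k\ge1$) and each $\psi_n(t)$ ($n\ge0$) exists as a unique element of $\mathcal A_{X,\Delta}$, and for all $n\ge0$ $$\psi_{n+1}(t)=\sum_{k=0}^n(-1)^k\frac{[n]_q!}{[n-k]_q!}\,\Delta_{k+1}(t)\,\psi_{n-k}(t).$$ -/

import Mathlib

open MeasureTheory TensorProduct
open scoped ComplexConjugate

noncomputable section

namespace QLevy

/-! ### `q`-numbers and the `q`-Kailath–Segall polynomials -/

/-- `[n]_q = 1 + q + ⋯ + q^(n-1)`. -/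
def qNum (q : ℝ) (n : ℕ) : ℝ := ∑ i ∈ Finset.range n, q ^ i

/-- `[n]_q! = [1]_q [2]_q ⋯ [n]_q`. -/
def qFact (q : ℝ) (n : ℕ) : ℝ := ∏ i ∈ Finset.Icc 1 n, qNum q i

/-- The non-commuting indeterminate `x_j`. Only positive indices `j` are meant to be used. -/
abbrev ksVar (j : ℕ) : FreeAlgebra ℝ ℕ := FreeAlgebra.ι ℝ j

/-- The `q`-Kailath–Segall polynomials `A_u` with parameters `r`, for a finite sequence `u` of
positive integers: `A_∅ = 1` and
`A_(j,u) = x_j A_u - ∑_i q^(i-1) r_(j+u(i)) A_(u∖u(i)) - ∑_i q^(i-1) A_(j+u(i), u∖u(i))`.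
Positions `i` are counted from `0` here, so that `q^(i-1)` becomes `q^i`. -/
def kailathSegall (q : ℝ) (r : ℕ → ℝ) : List ℕ → FreeAlgebra ℝ ℕ
  | [] => 1
  | j :: u =>
      ksVar j * kailathSegall q r u
        - ∑ i : Fin u.length, (q ^ (i : ℕ) * r (j + u[i])) • kailathSegall q r (u.eraseIdx i)
        - ∑ i : Fin u.length, q ^ (i : ℕ) • kailathSegall q r ((j + u[i]) :: u.eraseIdx i)
termination_by u => u.length
decreasing_by
  · simp
  · have := i.isLt
    simp only [List.length_cons, List.length_eraseIdx]
    split_ifs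
    all_goals omega
  · have := i.isLt
    simp only [List.length_cons, List.length_eraseIdx_of_lt this]
    omega

/-- The initial condition `A_j = x_j`. -/
theorem kailathSegall_singleton (q : ℝ) (r : ℕ → ℝ) (j : ℕ) :
    kailathSegall q r [j] = ksVar j := by
  rw [kailathSegall, kailathSegall]
  simp

/-! ### The `q`-Fock space over a complex inner product space `H` -/

section Fock

variable {H : Type*} [NormedAddCommGroup H] [InnerProductSpace ℂ H]

/-- The algebraic Fock space `⨁ₙ H^{⊗n}`; the vacuum vector `Ω` is `1`, and
`ξ₁ ⊗ ⋯ ⊗ ξₙ` is the product of the `ι ξᵢ`. -/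
abbrev Falg (H : Type*) [NormedAddCommGroup H] [InnerProductSpace ℂ H] : Type _ :=
  TensorAlgebra ℂ H

/-- The tensor `ξ₁ ⊗ ⋯ ⊗ ξₙ`. -/
def tens (l : List H) : Falg H := (l.map (TensorAlgebra.ι ℂ)).prod

/-- Auxiliary representation: `η` acts on pairs by
`(v, w) ↦ (η ⊗ v, η ⊗ v + q · (insert η in the second factor of w))`. -/
def pickAux (q : ℝ) : H →ₗ[ℂ] Module.End ℂ (Falg H × (H ⊗[ℂ] Falg H)) where
  toFun η :=
    ((LinearMap.mulLeft ℂ (TensorAlgebra.ι ℂ η)) ∘ₗ LinearMap.fst ℂ _ _).prod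
      ((TensorProduct.mk ℂ H (Falg H) η) ∘ₗ LinearMap.fst ℂ _ _
        + (q : ℂ) • ((LinearMap.mulLeft ℂ (TensorAlgebra.ι ℂ η)).lTensor H
            ∘ₗ LinearMap.snd ℂ _ _))
  map_add' η₁ η₂ := by
    ext v <;>
    simp [LinearMap.mulLeft, add_mul, TensorProduct.tmul_add]
  map_smul' c η := by
    ext v <;>
    simp [LinearMap.mulLeft, smul_comm]

/-- `η₁ ⊗ ⋯ ⊗ ηₙ ↦ ∑ₖ q^(k-1) ηₖ ⊗ (η₁ ⊗ ⋯ ⊗ η̌ₖ ⊗ ⋯ ⊗ ηₙ)`, see `pick_tens`. -/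
def pick (q : ℝ) : Falg H →ₗ[ℂ] H ⊗[ℂ] Falg H where
  toFun v := (TensorAlgebra.lift ℂ (pickAux (H := H) q) v (1, 0)).2
  map_add' _ _ := by simp
  map_smul' _ _ := by simp

/-- The creation operator `a*(ζ)`. -/
def creation (ζ : H) : Module.End ℂ (Falg H) :=
  LinearMap.mulLeft ℂ (TensorAlgebra.ι ℂ ζ)

/-- The annihilation operator `a(ζ)`, see `annihilation_tens`. -/
def annihilation (q : ℝ) (ζ : H) : Module.End ℂ (Falg H) :=
  (TensorProduct.lid ℂ (Falg H)).toLinearMap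
    ∘ₗ ((innerSL ℂ ζ : H →L[ℂ] ℂ) : H →ₗ[ℂ] ℂ).rTensor (Falg H) ∘ₗ pick q

/-- The gauge operator `p(T)`, see `gauge_tens`. -/
def gauge (q : ℝ) (T : H →ₗ[ℂ] H) : Module.End ℂ (Falg H) :=
  TensorProduct.lift ((LinearMap.mul ℂ (Falg H)) ∘ₗ TensorAlgebra.ι ℂ)
    ∘ₗ T.rTensor (Falg H) ∘ₗ pick q

/-- `p(ζ, T) = a(ζ) + a*(ζ) + p(T)`. -/
def fieldOp (q : ℝ) (ζ : H) (T : H →ₗ[ℂ] H) : Module.End ℂ (Falg H) :=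
  annihilation q ζ + creation ζ + gauge q T

/-- For fixed `w`, the map `v ↦ conj ⟨v, w⟩₀` is linear; it is built from
`⟨ζ ⊗ v, w⟩₀ = ⟨v, ℓ(ζ) w⟩₀`, where `ℓ(ζ)` is the free annihilation operator (`q = 0`). -/
def conjInner₀Aux :
    H →ₗ[ℂ] Module.End ℂ (Falg H →ₛₗ[starRingEnd ℂ] ℂ) where
  toFun ζ :=
    { toFun := fun L => L.comp (annihilation 0 ζ)
      map_add' := fun _ _ => rfl
      map_smul' := fun _ _ => rfl }
  map_add' ζ₁ ζ₂ := by
    ext L w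
    simp [annihilation, LinearMap.rTensor_add]
  map_smul' c ζ := by
    ext L w
    simp [annihilation, LinearMap.rTensor_smul]

/-- The functional `w ↦ conj ⟨Ω, w⟩₀`. -/
def conjVacuum : Falg H →ₛₗ[starRingEnd ℂ] ℂ where
  toFun w := conj (TensorAlgebra.algebraMapInv w)
  map_add' _ _ := by simp
  map_smul' _ _ := by simp

/-- The inner product `⟨v, w⟩₀` on the algebraic Fock space (conjugate-linear in `v`), in which
`⟨ξ₁ ⊗ ⋯ ⊗ ξₙ, η₁ ⊗ ⋯ ⊗ ηₖ⟩₀ = δₙₖ ∏ᵢ ⟨ξᵢ, ηᵢ⟩`, see `inner₀_tens`. -/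
def inner₀ (v w : Falg H) : ℂ :=
  conj (TensorAlgebra.lift ℂ (conjInner₀Aux (H := H)) v conjVacuum w)

/-- The number of inversions of a permutation. -/
def inversions {n : ℕ} (σ : Equiv.Perm (Fin n)) : ℕ :=
  (Finset.univ.filter fun p : Fin n × Fin n => p.1 < p.2 ∧ σ p.2 < σ p.1).card

/-- `P_n (ξ₁ ⊗ ⋯ ⊗ ξₙ) = ∑_σ q^{i(σ)} ξ_{σ(1)} ⊗ ⋯ ⊗ ξ_{σ(n)}`. -/
def symm (q : ℝ) (n : ℕ) : (⨂[ℂ]^n H) →ₗ[ℂ] (⨂[ℂ]^n H) :=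
  ∑ σ : Equiv.Perm (Fin n),
    (q : ℂ) ^ inversions σ • (PiTensorProduct.reindex ℂ (fun _ => H) σ.symm).toLinearMap

/-- The operator `P = ⨁ₙ P_n` on the algebraic Fock space. -/
def qSymm (q : ℝ) : Module.End ℂ (Falg H) :=
  TensorAlgebra.equivDirectSum.symm.toLinearMap
    ∘ₗ DirectSum.lmap (fun n => symm (H := H) q n)
    ∘ₗ TensorAlgebra.equivDirectSum.toLinearMap

/-- The `q`-inner product `⟨v, w⟩_q = ⟨v, P w⟩₀`. -/
def qInner (q : ℝ) (v w : Falg H) : ℂ := inner₀ v (qSymm q w)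

/-- The norm `‖A‖_φ = ⟨AΩ, AΩ⟩_q^{1/2}` of `L²(φ)`, where `φ(A) = ⟨Ω, A Ω⟩_q` is the vacuum
state. -/
def phiNorm (q : ℝ) (A : Module.End ℂ (Falg H)) : ℝ :=
  √(qInner q (A 1) (A 1)).re

/-! The formulas for the above objects on elementary tensors. -/

theorem tens_cons (η : H) (l : List H) : tens (η :: l) = TensorAlgebra.ι ℂ η * tens l := by
  simp [tens]

theorem pickAux_apply (q : ℝ) (η : H) (z : Falg H × (H ⊗[ℂ] Falg H)) :
    pickAux q η z = (TensorAlgebra.ι ℂ η * z.1, η ⊗ₜ[ℂ] z.1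
      + (q : ℂ) • (LinearMap.mulLeft ℂ (TensorAlgebra.ι ℂ η)).lTensor H z.2) := by
  simp [pickAux]

theorem lift_pickAux_fst (q : ℝ) (l : List H) :
    (TensorAlgebra.lift ℂ (pickAux (H := H) q) (tens l) (1, 0)).1 = tens l := by
  induction l with
  | nil => simp [tens]
  | cons η l ih =>
    rw [tens_cons, map_mul, Module.End.mul_apply, TensorAlgebra.lift_ι_apply, pickAux_apply, ih]

theorem pick_cons (q : ℝ) (η : H) (l : List H) :
    pick q (tens (η :: l)) = η ⊗ₜ[ℂ] tens l
      + (q : ℂ) • (LinearMap.mulLeft ℂ (TensorAlgebra.ι ℂ η)).lTensor H (pick q (tens l)) := by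
  simp only [pick, LinearMap.coe_mk, AddHom.coe_mk]
  rw [tens_cons, map_mul, Module.End.mul_apply, TensorAlgebra.lift_ι_apply, pickAux_apply,
    lift_pickAux_fst]

theorem pick_tens (q : ℝ) (l : List H) :
    pick q (tens l)
      = ∑ k : Fin l.length, (q : ℂ) ^ (k : ℕ) • (l[k] ⊗ₜ[ℂ] tens (l.eraseIdx k)) := by
  induction l with
  | nil => simp [tens, pick]
  | cons η l ih =>
    rw [pick_cons, ih]
    simp only [map_sum, Finset.smul_sum, List.length_cons]
    rw [Fin.sum_univ_succ]
    simp [tens_cons, smul_smul, pow_succ']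

theorem annihilation_tens (q : ℝ) (ζ : H) (l : List H) :
    annihilation q ζ (tens l)
      = ∑ k : Fin l.length, ((q : ℂ) ^ (k : ℕ) * inner ℂ ζ l[k]) • tens (l.eraseIdx k) := by
  simp [annihilation, pick_tens, smul_smul]

theorem gauge_tens (q : ℝ) (T : H →ₗ[ℂ] H) (l : List H) :
    gauge q T (tens l)
      = ∑ k : Fin l.length, (q : ℂ) ^ (k : ℕ) • tens (T l[k] :: l.eraseIdx k) := by
  simp [gauge, pick_tens, tens_cons]

theorem inner₀_ι_mul (ζ : H) (v w : Falg H) :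
    inner₀ (TensorAlgebra.ι ℂ ζ * v) w = inner₀ v (annihilation 0 ζ w) := by
  simp [inner₀, TensorAlgebra.lift_ι_apply, conjInner₀Aux]

theorem inner₀_tens (l m : List H) :
    inner₀ (tens l) (tens m)
      = if l.length = m.length then (List.zipWith (inner ℂ) l m).prod else 0 := by
  induction l generalizing m with
  | nil =>
    cases m with
    | nil => simp [inner₀, tens, conjVacuum]
    | cons η m => simp [inner₀, tens, conjVacuum, TensorAlgebra.algebraMapInv]
  | cons ζ l ih =>
    rw [tens_cons, inner₀_ι_mul]
    cases m with
    | nil => simp [annihilation_tens, inner₀]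
    | cons η m =>
      have h : annihilation 0 ζ (tens (η :: m)) = inner ℂ ζ η • tens m := by
        rw [annihilation_tens]
        refine (Fin.sum_univ_succ (n := m.length) _).trans ?_
        simp
      have h' : inner₀ (tens l) (inner ℂ ζ η • tens m)
          = inner ℂ ζ η * inner₀ (tens l) (tens m) := by
        simp [inner₀]
      rw [h, h', ih m]
      simp

theorem qSymm_tens (q : ℝ) {n : ℕ} (ξ : Fin n → H) :
    qSymm q (tens (List.ofFn ξ))
      = ∑ σ : Equiv.Perm (Fin n), (q : ℂ) ^ inversions σ • tens (List.ofFn (ξ ∘ σ)) := by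
  have key : ∀ ζ : Fin n → H, TensorAlgebra.equivDirectSum (tens (List.ofFn ζ)) =
      DirectSum.lof ℂ ℕ (fun n => ⨂[ℂ]^n H) n (PiTensorProduct.tprod ℂ ζ) := by
    intro ζ
    refine Eq.trans ?_ (TensorAlgebra.toDirectSum_tensorPower_tprod (R := ℂ) ζ)
    simp [tens, List.map_ofFn, Function.comp_def]
  apply TensorAlgebra.equivDirectSum.injective
  simp only [map_sum, map_smul, key]
  have h : TensorAlgebra.equivDirectSum (qSymm q (tens (List.ofFn ξ)))
      = DirectSum.lmap (fun n => symm (H := H) q n)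
          (TensorAlgebra.equivDirectSum (tens (List.ofFn ξ))) :=
    AlgEquiv.apply_symm_apply _ _
  rw [h, key, DirectSum.lmap_lof]
  simp [symm, Function.comp_def]

end Fock

/-! ### The `q`-Lévy process with canonical measure `ν` -/

section Levy

/-- The measure `dt ⊗ ν` on `ℝ₊ × ℝ`. -/
abbrev base (ν : Measure ℝ) : Measure (ℝ × ℝ) :=
  (volume.restrict (Set.Ici (0 : ℝ))).prod ν

/-- The Hilbert space `L²(ℝ₊, dt) ⊗ L²(ℝ, ν) = L²(ℝ₊ × ℝ, dt ⊗ ν)`. -/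
abbrev OneParticle (ν : Measure ℝ) : Type := Lp ℂ 2 (base ν)

/-- The function `χ_[a,b) ⊗ x^k`. -/
def box (a b : ℝ) (k : ℕ) (z : ℝ × ℝ) : ℂ :=
  (Set.Ico a b).indicator (fun _ => (z.2 : ℂ) ^ k) z.1

variable {ν : Measure ℝ}

theorem measurable_box (a b : ℝ) (k : ℕ) : Measurable (box a b k) := by
  have h : box a b k = (Prod.fst ⁻¹' Set.Ico a b).indicator (fun z : ℝ × ℝ => (z.2 : ℂ) ^ k) := by
    ext z
    simp only [box, Set.indicator, Set.mem_preimage]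
  rw [h]
  exact Measurable.indicator (by fun_prop) (measurable_fst measurableSet_Ico)

theorem exists_box_bound (hν : IsCompact ν.support) (a b : ℝ) (k : ℕ) :
    ∃ C : ℝ, 0 ≤ C ∧ ∀ᵐ z ∂(base ν), ‖box a b k z‖ ≤ C := by
  obtain ⟨C, hC⟩ := hν.isBounded.exists_norm_le
  refine ⟨|C| ^ k, by positivity, ?_⟩
  have h : ∀ᵐ y ∂ν, y ∈ ν.support := Measure.support_mem_ae
  have h2 : ∀ᵐ z ∂(base ν), z.2 ∈ ν.support :=
    (Measure.quasiMeasurePreserving_snd (μ := volume.restrict (Set.Ici (0 : ℝ))) (ν := ν)).ae h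
  filter_upwards [h2] with z hz
  simp only [box, Set.indicator]
  split_ifs
  · rw [norm_pow, Complex.norm_real]
    exact pow_le_pow_left₀ (norm_nonneg _) ((hC _ hz).trans (le_abs_self C)) k
  · simp

theorem memLp_top_box (hν : IsCompact ν.support) (a b : ℝ) (k : ℕ) :
    MemLp (box a b k) ⊤ (base ν) := by
  obtain ⟨C, -, hC⟩ := exists_box_bound hν a b k
  exact memLp_top_of_bound (measurable_box a b k).aestronglyMeasurable C hC

theorem memLp_two_box [IsProbabilityMeasure ν] (hν : IsCompact ν.support) (a b : ℝ) (k : ℕ) :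
    MemLp (box a b k) 2 (base ν) := by
  have hs : MeasurableSet (Prod.fst ⁻¹' Set.Ico a b : Set (ℝ × ℝ)) :=
    measurable_fst measurableSet_Ico
  have h : box a b k = (Prod.fst ⁻¹' Set.Ico a b).indicator (box a b k) := by
    ext z
    simp only [box, Set.indicator, Set.mem_preimage]
    split_ifs <;> rfl
  have hfin : base ν (Prod.fst ⁻¹' Set.Ico a b) < ⊤ := by
    rw [← Set.prod_univ, Measure.prod_prod]
    simp only [measure_univ, mul_one]
    exact (Measure.restrict_apply_le _ _).trans_lt (by simp)
  rw [h, memLp_indicator_iff_restrict hs]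
  have : IsFiniteMeasure ((base ν).restrict (Prod.fst ⁻¹' Set.Ico a b)) :=
    ⟨by simpa using hfin⟩
  exact ((memLp_top_box hν a b k).restrict _).mono_exponent le_top

/-- The vector `χ_[a,b) ⊗ x^k` of `L²(ℝ₊ × ℝ, dt ⊗ ν)`. -/
def boxVec [IsProbabilityMeasure ν] (hν : IsCompact ν.support) (a b : ℝ) (k : ℕ) : OneParticle ν :=
  (memLp_two_box hν a b k).toLp _

/-- The operator of multiplication by the bounded function `χ_[a,b) ⊗ x^k` on
`L²(ℝ₊ × ℝ, dt ⊗ ν)`. -/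
def boxMul (hν : IsCompact ν.support) (a b : ℝ) (k : ℕ) : OneParticle ν →ₗ[ℂ] OneParticle ν where
  toFun f := ((memLp_top_box hν a b k).toLp _ : Lp ℂ ⊤ (base ν)) • f
  map_add' f g := Lp.add_smul _ f g
  map_smul' c f := (Lp.smul_comm c ((memLp_top_box hν a b k).toLp _ : Lp ℂ ⊤ (base ν)) f).symm

theorem boxMul_ae (hν : IsCompact ν.support) (a b : ℝ) (k : ℕ) (f : OneParticle ν) :
    boxMul hν a b k f =ᵐ[base ν] fun z => box a b k z * f z := by
  have h1 := (memLp_top_box hν a b k).coeFn_toLp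
  have h2 := Lp.coeFn_lpSMul (r := 2) ((memLp_top_box hν a b k).toLp _ : Lp ℂ ⊤ (base ν)) f
  filter_upwards [h1, h2] with z hz1 hz2
  simp only [boxMul, LinearMap.coe_mk, AddHom.coe_mk, hz2, Pi.smul_apply', hz1, smul_eq_mul]

variable [IsProbabilityMeasure ν]

/-- The linear operators on the algebraic Fock space of `L²(ℝ₊ × ℝ, dt ⊗ ν)`, which is dense in the
`q`-Fock space. The operators `Y_k([a,b))` below leave it invariant; they are bounded for the
`q`-norm, so they and their polynomials are determined by their action on it. -/
abbrev Op (ν : Measure ℝ) : Type := Module.End ℂ (Falg (OneParticle ν))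

/-- The increments `Y_k([a,b)) = p(χ_[a,b) ⊗ x^(k-1), χ_[a,b) ⊗ x^k)`, for `k ≥ 1`. -/
def Y (q : ℝ) (hν : IsCompact ν.support) (k : ℕ) (a b : ℝ) : Op ν :=
  fieldOp q (boxVec hν a b (k - 1)) (boxMul hν a b k)

/-- The increments `X([a,b)) = Y_1([a,b))` of the `q`-Lévy process. -/
def X (q : ℝ) (hν : IsCompact ν.support) (a b : ℝ) : Op ν := Y q hν 1 a b

/-- The complex unital algebra generated by all `Y_k([a,b))`, `k ≥ 1`, `[a,b) ⊆ ℝ₊`. -/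
def algXΔ (q : ℝ) (hν : IsCompact ν.support) : Subalgebra ℂ (Op ν) :=
  Algebra.adjoin ℂ {A | ∃ (k : ℕ) (a b : ℝ), 1 ≤ k ∧ 0 ≤ a ∧ a < b ∧ A = Y q hν k a b}

/-- A subdivision `0 = s_0 < s_1 < ⋯ < s_N = t` of `[0,t)` into the intervals
`I_i = [s_i, s_(i+1))`. -/
structure Subdivision (t : ℝ) where
  /-- the number of intervals -/
  N : ℕ
  /-- the division points -/
  s : Fin (N + 1) → ℝ
  strictMono : StrictMono s
  first : s 0 = 0
  last : s (Fin.last N) = t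

/-- `D` is the diagonal measure `Δ_k(t)`: the limit in `L²(φ)` of `∑_i X(I_i)^k` over
subdivisions of `[0,t)`, as the length of the largest interval goes to `0`. -/
def IsDiagonalMeasure (q : ℝ) (hν : IsCompact ν.support) (k : ℕ) (t : ℝ) (D : Op ν) : Prop :=
  ∀ ε > 0, ∃ δ > 0, ∀ I : Subdivision t,
    (∀ i : Fin I.N, I.s i.succ - I.s i.castSucc < δ) →
      phiNorm q (∑ i : Fin I.N, X q hν (I.s i.castSucc) (I.s i.succ) ^ k - D) < ε

/-- A product `I_1 × ⋯ × I_n` of pairwise disjoint intervals `I_i = [lo i, hi i) ⊆ ℝ₊`. -/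
structure Rect (n : ℕ) where
  /-- left end points -/
  lo : Fin n → ℝ
  /-- right end points -/
  hi : Fin n → ℝ
  nonneg : ∀ i, 0 ≤ lo i
  lt : ∀ i, lo i < hi i
  disjoint : Pairwise fun i j => Disjoint (Set.Ico (lo i) (hi i)) (Set.Ico (lo j) (hi j))

/-- The indicator function of `I_1 × ⋯ × I_n`. -/
def Rect.fn {n : ℕ} (R : Rect n) : (Fin n → ℝ) → ℂ :=
  (Set.univ.pi fun i => Set.Ico (R.lo i) (R.hi i)).indicator 1

/-- The function represented by a formal linear combination of products of disjoint intervals. -/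
def simpleFn {n : ℕ} (S : Rect n →₀ ℂ) : (Fin n → ℝ) → ℂ :=
  fun y => S.sum fun R c => c * R.fn y

/-- The multiple stochastic integral of a simple function: the linear extension of
`∫ χ_{I_1 × ⋯ × I_n} dX ⋯ dX = X(I_1) X(I_2) ⋯ X(I_n)`. -/
def simpleIntegral (q : ℝ) (hν : IsCompact ν.support) {n : ℕ} (S : Rect n →₀ ℂ) : Op ν :=
  S.sum fun R c => c • (List.ofFn fun i => X q hν (R.lo i) (R.hi i)).prod

/-- `Z` is the multiple Wiener–Itô stochastic integral `∫ F dX(t_1) ⋯ dX(t_n)`: the value at `F` of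
the continuous extension, from simple functions in `L²(ℝ₊ⁿ)` to `L²(φ)`, of the integral of simple
functions. (For fixed `n` the usual and the `q`-deformed norm on `L²(ℝ₊ⁿ)` are equivalent.) -/
def IsMultipleIntegral (q : ℝ) (hν : IsCompact ν.support) {n : ℕ} (F : (Fin n → ℝ) → ℂ)
    (Z : Op ν) : Prop :=
  ∀ ε > 0, ∃ δ > 0, ∀ S : Rect n →₀ ℂ,
    eLpNorm (simpleFn S - F) 2 (Measure.pi fun _ => volume.restrict (Set.Ici (0 : ℝ))) < δ →
      phiNorm q (simpleIntegral q hν S - Z) < ε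

/-- `Z` is the full stochastic measure `ψ_n(t) = ∫ χ_{[0,t)^n} dX(t_1) ⋯ dX(t_n)`. -/
def IsFullStochasticMeasure (q : ℝ) (hν : IsCompact ν.support) (n : ℕ) (t : ℝ) (Z : Op ν) :
    Prop :=
  IsMultipleIntegral q hν ((Set.univ.pi fun _ : Fin n => Set.Ico 0 t).indicator 1) Z

end Levy

end QLevy

end

open QLevy

namespace QLevy

/-! ### The Kailath–Segall formulas for the polynomials -/

/-! For the polynomials, deleting any entry from a string of ones leaves the same shorter string, so
the powers of `q` in the recursion add up to a `q`-number. This gives a one-term recursion that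
trades `(j, n + 1 ones)` for `(j + 1, n ones)`; iterating it collects the `q`-numbers into `[n]_q! /
[n-k]_q!`. The second formula is the case `j = 1`, where the missing constant `r 1` vanishes.

For the process, everything is reduced to vectors in the algebraic Fock space. Two facts make this
legitimate. First, the `q`-inner product is definite: `inversions (σ⁻¹ * τ)` is the size of a
symmetric difference (`inversions_inv_mul`), and the kernel `q ^ |A ∆ B|` is diagonalized by the
characters of the group of subsets, with positive weights (`sum_cubeWeight`). Secondly, the vacuum
is separating for the algebra generated by the `Y_k` (`eq_zero_of_mem_algXΔ`): the creation part of
a generator determines the rest linearly, so every element of the algebra is the image of a tensor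
`P`, and it sends the vacuum to a vector with the same leading term as `P`. Hence an element of the
algebra is determined by its vacuum vector, and an `L²` limit in the algebra is unique.

The limits are then computed on the vacuum. Applying `X(I)^(k+1)` gives `χ_I ⊗ x^k`, a multiple `|I|
r_(k+1)` of the vacuum, and terms whose sums over fine subdivisions vanish
(`exists_X_pow_apply_one`, `negligible_of_mem_higherOrder`); the first two are additive in `I`. For
disjoint intervals a product of increments only creates, so multiple integrals are isometric to
`L²(ℝ₊ⁿ)` for the free inner product, and the `q`-norm is bounded by `√n!` times that norm; thus
`ψ_n` has vacuum vector `χ_[0,t)^{⊗n}`.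

On these vectors the formula is a telescoping sum (`sum_diag_cubeTens`). Read as a recursive
definition, it also produces elements of the algebra with the required vacuum vectors, which settles
the existence of `ψ_n`. -/

theorem qNum_pos {q : ℝ} (hq₁ : -1 < q) (hq₂ : q < 1) {n : ℕ} (hn : 1 ≤ n) : 0 < qNum q n := by
  have h : (1 - q) * qNum q n = 1 - q ^ n := by
    rw [qNum, mul_comm, geom_sum_mul_neg]
  have h1 : |q| < 1 := abs_lt.2 ⟨hq₁, hq₂⟩
  have h2 : q ^ n < 1 := by
    refine (le_abs_self _).trans_lt ?_
    rw [abs_pow]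
    exact pow_lt_one₀ (abs_nonneg q) h1 (by omega)
  by_contra! h3
  nlinarith

theorem qFact_succ (q : ℝ) (n : ℕ) : qFact q (n + 1) = qNum q (n + 1) * qFact q n := by
  rw [qFact, Finset.prod_Icc_succ_top (by omega), mul_comm, qFact]

theorem qFact_pos {q : ℝ} (hq₁ : -1 < q) (hq₂ : q < 1) (n : ℕ) : 0 < qFact q n :=
  Finset.prod_pos fun _ hi => qNum_pos hq₁ hq₂ (Finset.mem_Icc.1 hi).1

/-- All deletions from a constant string coincide, so the weights `q ^ i` sum to a single
`q`-number. -/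
theorem kailathSegall_cons_replicate (q : ℝ) (r : ℕ → ℝ) (j n : ℕ) :
    kailathSegall q r (j :: List.replicate (n + 1) 1)
      = ksVar j * kailathSegall q r (List.replicate (n + 1) 1)
        - qNum q (n + 1) • (r (j + 1) • kailathSegall q r (List.replicate n 1)
          + kailathSegall q r ((j + 1) :: List.replicate n 1)) := by
  have he : ∀ i : Fin (List.replicate (n + 1) 1).length,
      (List.replicate (n + 1) 1).eraseIdx i = List.replicate n 1 := by
    intro i
    have hi : (i : ℕ) < n + 1 := i.isLt.trans_eq List.length_replicate
    simp [List.eraseIdx_replicate, hi]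
  have hs : ∑ i : Fin (List.replicate (n + 1) 1).length, q ^ (i : ℕ) = qNum q (n + 1) := by
    rw [Fin.sum_univ_eq_sum_range (fun i => q ^ i), List.length_replicate, qNum]
  rw [kailathSegall]
  simp only [he, Fin.getElem_fin, List.getElem_replicate]
  rw [← Finset.sum_smul, ← Finset.sum_smul, ← Finset.sum_mul, hs, smul_add, smul_smul, sub_sub]

/-- Induction on `n` with `j` free, since the recursion passes from `j` to `j + 1`. Positivity of
the `q`-factorials permits the cancellation of `qFact q n`. -/
theorem kailathSegall_cons_ones {q : ℝ} (hq₁ : -1 < q) (hq₂ : q < 1) (r : ℕ → ℝ) (j n : ℕ) :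
    kailathSegall q r (j :: List.replicate n 1)
      = ksVar j * kailathSegall q r (List.replicate n 1)
        + ∑ k ∈ Finset.Icc 1 n, ((-1) ^ k * (qFact q n / qFact q (n - k))) •
            ((ksVar (j + k) + algebraMap ℝ _ (r (j + k)))
              * kailathSegall q r (List.replicate (n - k) 1)) := by
  induction n generalizing j with
  | zero =>
    rw [List.replicate_zero, kailathSegall_singleton, kailathSegall]
    simp
  | succ n ih =>
    have h0 := (qFact_pos hq₁ hq₂ n).ne'
    -- The summand `k = 1` is split off: it combines the `r (j + 1)` term with the leading product
    -- of the induction hypothesis for `j + 1`. The others are the sum in that hypothesis, shifted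
    -- by one.
    rw [kailathSegall_cons_replicate, ih, sub_eq_add_neg, add_right_inj,
      ← Finset.sum_erase_add _ _ (Finset.mem_Icc.2 ⟨le_rfl, Nat.le_add_left 1 n⟩ :
        1 ∈ Finset.Icc 1 (n + 1))]
    have hIcc : (Finset.Icc 1 (n + 1)).erase 1 = (Finset.Icc 1 n).map (addRightEmbedding 1) := by
      ext i
      simp only [Finset.mem_erase, Finset.mem_Icc, Finset.map_add_right_Icc]
      omega
    rw [hIcc, Finset.sum_map, ← add_assoc, smul_add, neg_add,
      add_comm (-(qNum q (n + 1) • (_ + _)))]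
    congr 1
    · rw [Finset.smul_sum, ← Finset.sum_neg_distrib]
      refine Finset.sum_congr rfl fun k _ => ?_
      rw [← neg_smul, smul_smul, addRightEmbedding_apply, Nat.add_sub_add_right, qFact_succ,
        add_assoc j, add_comm 1 k]
      congr 1
      ring
    · rw [Nat.add_sub_cancel, pow_one, qFact_succ, mul_div_cancel_right₀ _ h0, add_mul,
        ← Algebra.smul_def, neg_one_mul, neg_smul,
        add_comm (r (j + 1) • _)]

theorem kailathSegall_ones {q : ℝ} (hq₁ : -1 < q) (hq₂ : q < 1) (r : ℕ → ℝ) (n : ℕ)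
    (hr : r 1 = 0) :
    kailathSegall q r (List.replicate (n + 1) 1)
      = ∑ k ∈ Finset.range (n + 1), ((-1) ^ k * (qFact q n / qFact q (n - k))) •
            ((ksVar (k + 1) + algebraMap ℝ _ (r (k + 1)))
              * kailathSegall q r (List.replicate (n - k) 1)) := by
  rw [List.replicate_succ, kailathSegall_cons_ones hq₁ hq₂, Finset.sum_range_succ']
  rw [Nat.sub_zero, zero_add, pow_zero, one_mul, div_self (qFact_pos hq₁ hq₂ n).ne', one_smul, hr,
    map_zero, add_zero, add_comm, Finset.range_eq_Ico, Finset.sum_Ico_add'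
      (fun k => ((-1) ^ k * (qFact q n / qFact q (n - k))) •
        ((ksVar (k + 1) + algebraMap ℝ _ (r (k + 1)))
          * kailathSegall q r (List.replicate (n - k) 1))) 0 n 1]
  congr 1
  refine Finset.sum_congr ?_ fun k _ => by rw [add_comm 1 k]
  ext; simp

/-! ### Inversions -/

/-- The pairs `a < b` whose order is reversed by `σ⁻¹`. -/
def reversed {n : ℕ} (σ : Equiv.Perm (Fin n)) : Finset (Fin n × Fin n) :=
  Finset.univ.filter fun p => p.1 < p.2 ∧ σ.symm p.2 < σ.symm p.1

/-- A pair of positions is inverted by `σ⁻¹ * τ` exactly when the corresponding pair of values of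
`τ` has its order reversed by one of `σ⁻¹`, `τ⁻¹` but not by both. Sorting the two values gives the
bijection. -/
theorem inversions_inv_mul {n : ℕ} (σ τ : Equiv.Perm (Fin n)) :
    inversions (σ⁻¹ * τ) = (symmDiff (reversed σ) (reversed τ)).card := by
  unfold inversions reversed
  refine Finset.card_bij (fun p _ => (min (τ p.1) (τ p.2), max (τ p.1) (τ p.2))) ?_ ?_ ?_
  · rintro ⟨i, j⟩ h
    rw [Finset.mem_filter] at h
    replace h := h.2
    simp only [Equiv.Perm.mul_apply, Equiv.Perm.coe_inv] at h
    rw [Finset.mem_symmDiff]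
    simp only [Finset.mem_filter, Finset.mem_univ, true_and]
    rcases lt_trichotomy (τ i) (τ j) with h1 | h1 | h1
    · left
      rw [min_eq_left h1.le, max_eq_right h1.le]
      simp only [Equiv.symm_apply_apply]
      exact ⟨⟨h1, h.2⟩, fun h2 => lt_asymm h2.2 h.1⟩
    · exact absurd (τ.injective h1) h.1.ne
    · right
      rw [min_eq_right h1.le, max_eq_left h1.le]
      simp only [Equiv.symm_apply_apply]
      exact ⟨⟨h1, h.1⟩, fun h2 => lt_asymm h2.2 h.2⟩
  · rintro ⟨i, j⟩ h ⟨k, l⟩ h' heq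
    simp only [Finset.mem_filter, Finset.mem_univ, true_and] at h h'
    simp only [Prod.mk.injEq] at heq ⊢
    rcases le_total (τ i) (τ j) with h1 | h1 <;> rcases le_total (τ k) (τ l) with h2 | h2 <;>
      simp only [h1, h2, min_eq_left, max_eq_right, min_eq_right, max_eq_left,
        EmbeddingLike.apply_eq_iff_eq] at heq
    · exact heq
    · omega
    · omega
    · exact heq.symm
  · rintro ⟨a, b⟩ h
    rw [Finset.mem_symmDiff] at h
    simp only [Finset.mem_filter, Finset.mem_univ, true_and] at h
    have hτ : ∀ {x y : Fin n}, x < y → ¬ τ.symm y < τ.symm x → τ.symm x < τ.symm y := fun hxy h1 =>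
      lt_of_le_of_ne (not_lt.1 h1) fun h2 => hxy.ne (τ.symm.injective h2)
    have hσ : ∀ {x y : Fin n}, x < y → ¬ σ.symm y < σ.symm x → σ.symm x < σ.symm y := fun hxy h1 =>
      lt_of_le_of_ne (not_lt.1 h1) fun h2 => hxy.ne (σ.symm.injective h2)
    rcases h with ⟨⟨h1, h2⟩, h3⟩ | ⟨⟨h1, h2⟩, h3⟩
    · refine ⟨(τ.symm a, τ.symm b), ?_, ?_⟩
      · refine Finset.mem_filter.2 ⟨Finset.mem_univ _, ?_⟩
        simp only [Equiv.Perm.mul_apply, Equiv.Perm.coe_inv, Equiv.apply_symm_apply]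
        exact ⟨hτ h1 fun h4 => h3 ⟨h1, h4⟩, h2⟩
      · simp [h1.le]
    · refine ⟨(τ.symm b, τ.symm a), ?_, ?_⟩
      · refine Finset.mem_filter.2 ⟨Finset.mem_univ _, ?_⟩
        simp only [Equiv.Perm.mul_apply, Equiv.Perm.coe_inv, Equiv.apply_symm_apply]
        exact ⟨h2, hσ h1 fun h4 => h3 ⟨h1, h4⟩⟩
      · simp [h1.le]

theorem inversions_inv {n : ℕ} (σ : Equiv.Perm (Fin n)) : inversions σ⁻¹ = inversions σ := by
  have h1 := inversions_inv_mul σ 1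
  have h2 := inversions_inv_mul 1 σ
  rw [mul_one] at h1
  rw [inv_one, one_mul] at h2
  rw [h1, h2, symmDiff_comm]

/-- Without inversions `σ` is an order automorphism of `Fin n`, and there is only one. -/
theorem eq_one_of_inversions_eq_zero {n : ℕ} {σ : Equiv.Perm (Fin n)} (h : inversions σ = 0) :
    σ = 1 := by
  rw [inversions, Finset.card_eq_zero, Finset.filter_eq_empty_iff] at h
  have hmono : StrictMono σ := fun i j hij =>
    lt_of_le_of_ne (not_lt.1 fun h1 => h (Finset.mem_univ (i, j)) ⟨hij, h1⟩)
      fun h2 => hij.ne (σ.injective h2)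
  have := Subsingleton.elim (hmono.orderIsoOfSurjective σ σ.surjective) (OrderIso.refl (Fin n))
  ext i
  exact congrArg (fun e : Fin n ≃o Fin n => (e i : ℕ)) this

/-! ### Positive definiteness of `(A, B) ↦ q ^ |A ∆ B|` -/

section Kernel

variable {ε : Type*} [Fintype ε] [DecidableEq ε]

/-- The eigenvalues of the matrix `q ^ |A ∆ B|`, up to normalization. -/
noncomputable def cubeWeight (q : ℝ) (C : Finset ε) : ℝ :=
  (∏ _e ∈ C, (1 - q) / 2) * ∏ _e ∈ Finset.univ \ C, (1 + q) / 2

/-- The character of the group of subsets of `ε` corresponding to `C`. -/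
def cubeChar (C A : Finset ε) : ℝ := ∏ e ∈ C, if e ∈ A then -1 else 1

theorem cubeWeight_pos {q : ℝ} (hq₁ : -1 < q) (hq₂ : q < 1) (C : Finset ε) :
    0 < cubeWeight q C :=
  mul_pos (Finset.prod_pos fun _ _ => by linarith) (Finset.prod_pos fun _ _ => by linarith)

/-- Expansion over subsets `C` of a product over `e` of factors `±(1 - q)/2 + (1 + q)/2`. The sign
is negative, and the factor equal to `q`, exactly for `e` in the symmetric difference; otherwise the
factor is `1`. -/
theorem sum_cubeWeight (q : ℝ) (A B : Finset ε) :
    ∑ C, cubeWeight q C * (cubeChar C A * cubeChar C B) = q ^ (symmDiff A B).card := by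
  have h : ∀ e, (1 - q) / 2 * ((if e ∈ A then -1 else 1) * (if e ∈ B then -1 else 1)) + (1 + q) / 2
      = if e ∈ symmDiff A B then q else 1 := by
    intro e
    by_cases hA : e ∈ A <;> by_cases hB : e ∈ B <;> simp [hA, hB, Finset.mem_symmDiff] <;> ring
  have h2 : q ^ (symmDiff A B).card = ∏ e, if e ∈ symmDiff A B then q else 1 := by
    rw [Finset.prod_ite_mem, Finset.univ_inter, Finset.prod_const]
  rw [h2, ← Finset.prod_congr rfl fun e _ => h e, Finset.prod_add, Finset.powerset_univ]
  refine Finset.sum_congr rfl fun C _ => ?_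
  simp only [cubeWeight, cubeChar, Finset.prod_mul_distrib]
  ring

end Kernel

theorem sum_inversions_form {n : ℕ} (q : ℝ) (x : Equiv.Perm (Fin n) → ℂ) :
    ∑ σ, ∑ τ, (q : ℂ) ^ inversions (σ⁻¹ * τ) * (conj (x σ) * x τ)
      = ((∑ C, cubeWeight q C * ‖∑ σ, (cubeChar C (reversed σ) : ℂ) * x σ‖ ^ 2 : ℝ) : ℂ) := by
  have h : ∀ C, ((‖∑ σ, (cubeChar C (reversed σ) : ℂ) * x σ‖ ^ 2 : ℝ) : ℂ)
      = ∑ σ, ∑ τ, ((cubeChar C (reversed σ) * cubeChar C (reversed τ) : ℝ) : ℂ)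
          * (conj (x σ) * x τ) := by
    intro C
    rw [Complex.ofReal_pow, ← Complex.conj_mul', map_sum, Finset.sum_mul_sum]
    refine Finset.sum_congr rfl fun σ _ => Finset.sum_congr rfl fun τ _ => ?_
    rw [map_mul, Complex.conj_ofReal]
    push_cast
    ring
  simp only [Complex.ofReal_sum, Complex.ofReal_mul, h, inversions_inv_mul]
  simp only [← Complex.ofReal_pow, ← sum_cubeWeight, Finset.mul_sum, Complex.ofReal_sum,
    Finset.sum_mul]
  rw [Finset.sum_comm' (t' := Finset.univ) (s' := fun _ => Finset.univ) (by simp)]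
  conv_rhs => rw [Finset.sum_comm]
  rw [Finset.sum_comm]
  refine Finset.sum_congr rfl fun σ _ => ?_
  rw [Finset.sum_comm]
  refine Finset.sum_congr rfl fun τ _ => Finset.sum_congr rfl fun C _ => ?_
  push_cast
  ring

/-- The diagonalization at `q = 0` serves as an inversion formula: `0 ^ inversions (τ⁻¹ * σ)` is the
Kronecker delta, so `x τ` is a combination of the transforms. -/
theorem eq_zero_of_transform_eq_zero {n : ℕ} {x : Equiv.Perm (Fin n) → ℂ}
    (h : ∀ C, ∑ σ, (cubeChar C (reversed σ) : ℂ) * x σ = 0) (τ : Equiv.Perm (Fin n)) :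
    x τ = 0 := by
  have h1 : ∀ σ, ((0 : ℝ) : ℂ) ^ inversions (τ⁻¹ * σ) = if σ = τ then 1 else 0 := by
    intro σ
    split_ifs with hσ
    · have : inversions (1 : Equiv.Perm (Fin n)) = 0 := by
        rw [inversions, Finset.card_eq_zero, Finset.filter_eq_empty_iff]
        exact fun p _ h => lt_asymm h.1 h.2
      rw [hσ, inv_mul_cancel, this, pow_zero]
    · rw [Complex.ofReal_zero, zero_pow]
      exact fun h2 => hσ (inv_mul_eq_one.1 (eq_one_of_inversions_eq_zero h2)).symm
  have h2 : x τ = ∑ σ, ((0 : ℝ) : ℂ) ^ inversions (τ⁻¹ * σ) * x σ := by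
    simp only [h1, ite_mul, one_mul, zero_mul, Finset.sum_ite_eq', Finset.mem_univ, if_true]
  rw [h2]
  simp only [inversions_inv_mul, ← Complex.ofReal_pow, ← sum_cubeWeight, Complex.ofReal_sum,
    Finset.sum_mul]
  rw [Finset.sum_comm]
  refine Finset.sum_eq_zero fun C _ => ?_
  have := congrArg (fun z : ℂ => (cubeWeight 0 C * cubeChar C (reversed τ) : ℝ) * z) (h C)
  simp only [Finset.mul_sum, mul_zero] at this
  rw [← this]
  refine Finset.sum_congr rfl fun σ _ => ?_
  push_cast
  ring

/-! ### The `q`-inner product is an inner product -/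

section Positivity

variable {H : Type*} [NormedAddCommGroup H] [InnerProductSpace ℂ H]

theorem inner₀_add_left (u v w : Falg H) : inner₀ (u + v) w = inner₀ u w + inner₀ v w := by
  simp [inner₀]

theorem inner₀_smul_left (c : ℂ) (v w : Falg H) : inner₀ (c • v) w = conj c * inner₀ v w := by
  simp [inner₀]

theorem inner₀_add_right (u v w : Falg H) : inner₀ u (v + w) = inner₀ u v + inner₀ u w := by
  simp [inner₀]

theorem inner₀_smul_right (c : ℂ) (v w : Falg H) : inner₀ v (c • w) = c * inner₀ v w := by
  simp [inner₀]

/-- The `q`-inner product as a sesquilinear map. -/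
noncomputable def qForm (q : ℝ) : Falg H →ₗ⋆[ℂ] Falg H →ₗ[ℂ] ℂ :=
  LinearMap.mk₂'ₛₗ _ _ (qInner q)
    (fun _ _ _ => inner₀_add_left _ _ _) (fun _ _ _ => inner₀_smul_left _ _ _)
    (fun _ _ _ => by simp only [qInner, map_add, inner₀_add_right])
    (fun _ _ _ => by simp only [qInner, map_smul, inner₀_smul_right, RingHom.id_apply, smul_eq_mul])

theorem qForm_apply (q : ℝ) (v w : Falg H) : qForm q v w = qInner q v w := rfl

theorem qInner_sum_smul {ι κ : Type*} (q : ℝ) (s : Finset ι) (t : Finset κ) (b : ι → ℂ)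
    (c : κ → ℂ) (v : ι → Falg H) (w : κ → Falg H) :
    qInner q (∑ i ∈ s, b i • v i) (∑ j ∈ t, c j • w j)
      = ∑ i ∈ s, ∑ j ∈ t, conj (b i) * c j * qInner q (v i) (w j) := by
  simp only [← qForm_apply, map_sum, map_smul, LinearMap.sum_apply, map_smulₛₗ,
    LinearMap.smul_apply, smul_eq_mul, Finset.mul_sum]
  rw [Finset.sum_comm]
  exact Finset.sum_congr rfl fun i _ => Finset.sum_congr rfl fun j _ => by ring

theorem inner₀_sum_smul {ι κ : Type*} (s : Finset ι) (t : Finset κ) (b : ι → ℂ)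
    (c : κ → ℂ) (v : ι → Falg H) (w : κ → Falg H) :
    inner₀ (∑ i ∈ s, b i • v i) (∑ j ∈ t, c j • w j)
      = ∑ i ∈ s, ∑ j ∈ t, conj (b i) * c j * inner₀ (v i) (w j) := by
  simp only [inner₀, map_sum, map_smul, LinearMap.sum_apply, LinearMap.smul_apply, map_smulₛₗ,
    smul_eq_mul, map_mul, Finset.mul_sum, Complex.conj_conj]
  rw [Finset.sum_comm]
  exact Finset.sum_congr rfl fun i _ => Finset.sum_congr rfl fun j _ => by ring

theorem qInner_tens_of_ne (q : ℝ) {m n : ℕ} (h : m ≠ n) (ξ : Fin m → H) (η : Fin n → H) :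
    qInner q (tens (List.ofFn ξ)) (tens (List.ofFn η)) = 0 := by
  rw [qInner, qSymm_tens]
  have : ∀ σ : Equiv.Perm (Fin n), inner₀ (tens (List.ofFn ξ)) (tens (List.ofFn (η ∘ σ))) = 0 := by
    intro σ
    rw [inner₀_tens, if_neg (by simpa using h)]
  simp only [inner₀, map_sum] at this ⊢
  simp [this]

theorem inner₀_tens_ofFn {n : ℕ} (ξ η : Fin n → H) :
    inner₀ (tens (List.ofFn ξ)) (tens (List.ofFn η)) = ∏ i, inner ℂ (ξ i) (η i) := by
  rw [inner₀_tens, if_pos (by simp)]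
  have : List.zipWith (inner ℂ) (List.ofFn ξ) (List.ofFn η)
      = List.ofFn fun i => inner ℂ (ξ i) (η i) := by
    apply List.ext_getElem <;> simp
  rw [this, List.prod_ofFn]

theorem qInner_tens (q : ℝ) {n : ℕ} (ξ η : Fin n → H) :
    qInner q (tens (List.ofFn ξ)) (tens (List.ofFn η))
      = ∑ σ : Equiv.Perm (Fin n), (q : ℂ) ^ inversions σ * ∏ i, inner ℂ (ξ i) (η (σ i)) := by
  have : ∀ σ : Equiv.Perm (Fin n), inner₀ (tens (List.ofFn ξ)) (tens (List.ofFn (η ∘ σ)))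
      = ∏ i, inner ℂ (ξ i) (η (σ i)) := fun σ => inner₀_tens_ofFn _ _
  rw [qInner, qSymm_tens]
  simp only [inner₀, map_sum] at this ⊢
  simp [this]

theorem conj_qInner_tens (q : ℝ) {m n : ℕ} (ξ : Fin m → H) (η : Fin n → H) :
    conj (qInner q (tens (List.ofFn η)) (tens (List.ofFn ξ)))
      = qInner q (tens (List.ofFn ξ)) (tens (List.ofFn η)) := by
  by_cases h : m = n
  · subst h
    rw [qInner_tens, qInner_tens, map_sum, ← Equiv.sum_comp (Equiv.inv (Equiv.Perm (Fin m)))]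
    refine Finset.sum_congr rfl fun σ _ => ?_
    simp only [Equiv.inv_apply, inversions_inv, map_mul, map_pow, Complex.conj_ofReal, map_prod,
      inner_conj_symm]
    congr 1
    rw [← Equiv.prod_comp σ]
    simp
  · rw [qInner_tens_of_ne q h, qInner_tens_of_ne q (Ne.symm h), map_zero]

/-- The tensors of degree `n`. -/
def degreePart (H : Type*) [NormedAddCommGroup H] [InnerProductSpace ℂ H] (n : ℕ) :
    Submodule ℂ (Falg H) :=
  Submodule.span ℂ (Set.range fun ξ : Fin n → H => tens (List.ofFn ξ))

theorem tens_ofFn_mem {n : ℕ} (ξ : Fin n → H) : tens (List.ofFn ξ) ∈ degreePart H n :=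
  Submodule.subset_span ⟨ξ, rfl⟩

theorem tens_mem_degreePart (l : List H) : tens l ∈ degreePart H l.length := by
  have h := tens_ofFn_mem l.get
  rwa [List.ofFn_get] at h

theorem tens_append (l m : List H) : tens (l ++ m) = tens l * tens m := by simp [tens]

theorem exists_eq_sum_degreePart (v : Falg H) :
    ∃ (N : ℕ) (w : ℕ → Falg H), (∀ n, w n ∈ degreePart H n) ∧ v = ∑ n ∈ Finset.range N, w n := by
  have hspan : v ∈ Submodule.span ℂ (Set.range (tens : List H → Falg H)) := by
    induction v using TensorAlgebra.induction with
    | algebraMap c =>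
      rw [Algebra.algebraMap_eq_smul_one]
      exact Submodule.smul_mem _ _ (Submodule.subset_span ⟨[], by simp [tens]⟩)
    | ι x => exact Submodule.subset_span ⟨[x], by simp [tens]⟩
    | add a b ha hb => exact Submodule.add_mem _ ha hb
    | mul a b ha hb =>
      have := Submodule.mul_mem_mul ha hb
      rw [Submodule.span_mul_span] at this
      refine Submodule.span_mono ?_ this
      rintro _ ⟨_, ⟨l, rfl⟩, _, ⟨m, rfl⟩, rfl⟩
      exact ⟨l ++ m, tens_append l m⟩
  induction hspan using Submodule.span_induction with
  | mem v hv =>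
    obtain ⟨l, rfl⟩ := hv
    refine ⟨l.length + 1, fun n => if n = l.length then tens l else 0, fun n => ?_, by simp⟩
    dsimp only
    split_ifs with h
    · rw [h]
      exact tens_mem_degreePart l
    · exact zero_mem _
  | zero => exact ⟨0, 0, fun _ => zero_mem _, by simp⟩
  | add u v _ _ hu hv =>
    obtain ⟨N, w, hw, rfl⟩ := hu
    obtain ⟨N', w', hw', rfl⟩ := hv
    refine ⟨max N N', fun n => (if n < N then w n else 0) + if n < N' then w' n else 0,
      fun n => add_mem ?_ ?_, ?_⟩
    · split_ifs
      exacts [hw n, zero_mem _]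
    · split_ifs
      exacts [hw' n, zero_mem _]
    · rw [Finset.sum_add_distrib, ← Finset.sum_filter, ← Finset.sum_filter]
      congr 2 <;> ext n <;> simp <;> omega
  | smul c v _ hv =>
    obtain ⟨N, w, hw, rfl⟩ := hv
    exact ⟨N, fun n => c • w n, fun n => Submodule.smul_mem _ _ (hw n), Finset.smul_sum⟩

/-- Only finitely many vectors of `H` occur in `v`. They span a finite-dimensional space; an
orthonormal basis of it and multilinearity give the expansion. -/
theorem exists_orthonormal_coordinates {n : ℕ} {v : Falg H} (hv : v ∈ degreePart H n) :
    ∃ (d : ℕ) (e : Fin d → H) (c : (Fin n → Fin d) → ℂ), Orthonormal ℂ e ∧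
      v = ∑ f, c f • tens (List.ofFn (e ∘ f)) := by
  classical
  obtain ⟨b, hb⟩ := Finsupp.mem_span_range_iff_exists_finsupp.1 hv
  let S : Finset H := b.support.biUnion fun ξ => Finset.univ.image ξ
  let V : Submodule ℂ H := Submodule.span ℂ (S : Set H)
  have : FiniteDimensional ℂ V := FiniteDimensional.span_finset ℂ S
  let e := stdOrthonormalBasis ℂ V
  have he : Orthonormal ℂ fun i => (e i : H) := e.orthonormal.comp_linearIsometry V.subtypeₗᵢ
  have hmem : v ∈ Submodule.span ℂ (Set.range
      fun f : Fin n → Fin (Module.finrank ℂ V) => tens (List.ofFn ((fun i => (e i : H)) ∘ f))) := by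
    rw [← hb]
    refine Submodule.sum_mem _ fun ξ hξ => Submodule.smul_mem _ _ ?_
    have hξV : ∀ i, ξ i ∈ V := fun i => Submodule.subset_span
      (Finset.mem_biUnion.2 ⟨ξ, hξ, Finset.mem_image_of_mem _ (Finset.mem_univ i)⟩)
    have hexp : ξ = fun i => ∑ j, e.repr ⟨ξ i, hξV i⟩ j • (e j : H) := by
      funext i
      have := congrArg (fun x : V => (x : H)) (e.sum_repr ⟨ξ i, hξV i⟩)
      simp only [AddSubmonoidClass.coe_finsetSum, Submodule.coe_smul] at this
      exact this.symm
    have htens : ∀ η : Fin n → H, tens (List.ofFn η) = TensorAlgebra.tprod ℂ H n η := by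
      intro η
      rw [TensorAlgebra.tprod_apply, tens, List.map_ofFn]
      rfl
    rw [hexp, htens, MultilinearMap.map_sum]
    refine Submodule.sum_mem _ fun f _ => ?_
    rw [MultilinearMap.map_smul_univ, ← htens]
    exact Submodule.smul_mem _ _ (Submodule.subset_span ⟨f, rfl⟩)
  obtain ⟨c, hc⟩ := (Submodule.mem_span_range_iff_exists_fun ℂ).1 hmem
  exact ⟨_, _, c, he, hc.symm⟩

section Coordinates

variable {n d : ℕ} {e : Fin d → H}

theorem qInner_tens_orthonormal (q : ℝ) (he : Orthonormal ℂ e) (f g : Fin n → Fin d) :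
    qInner q (tens (List.ofFn (e ∘ f))) (tens (List.ofFn (e ∘ g)))
      = ∑ σ : Equiv.Perm (Fin n), (q : ℂ) ^ inversions σ * if f = g ∘ σ then 1 else 0 := by
  rw [qInner_tens]
  refine Finset.sum_congr rfl fun σ _ => ?_
  congr 1
  simp only [Function.comp_apply, orthonormal_iff_ite.1 he, Finset.prod_ite_zero,
    Finset.prod_const_one, Finset.mem_univ, true_implies, funext_iff]

theorem qInner_coordinates (q : ℝ) (he : Orthonormal ℂ e) (c : (Fin n → Fin d) → ℂ) :
    qInner q (∑ f, c f • tens (List.ofFn (e ∘ f))) (∑ f, c f • tens (List.ofFn (e ∘ f)))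
      = ∑ σ : Equiv.Perm (Fin n), (q : ℂ) ^ inversions σ * ∑ g, conj (c (g ∘ σ)) * c g := by
  rw [qInner_sum_smul]
  simp only [qInner_tens_orthonormal q he, Finset.mul_sum]
  rw [Finset.sum_comm]
  rw [Finset.sum_comm (s := (Finset.univ : Finset (Equiv.Perm (Fin n))))]
  refine Finset.sum_congr rfl fun g _ => ?_
  rw [Finset.sum_comm]
  refine Finset.sum_congr rfl fun σ _ => ?_
  simp only [mul_ite, mul_one, mul_zero, Finset.sum_ite_eq', Finset.mem_univ, if_true]
  ring

/-- Averaging over the symmetric group turns the sum over one permutation into the positive form in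
two permutations of `sum_inversions_form`. -/
theorem factorial_mul_qInner (q : ℝ) (he : Orthonormal ℂ e) (c : (Fin n → Fin d) → ℂ) :
    (n.factorial : ℂ) *
      qInner q (∑ f, c f • tens (List.ofFn (e ∘ f))) (∑ f, c f • tens (List.ofFn (e ∘ f)))
      = ((∑ g : Fin n → Fin d, ∑ C, cubeWeight q C *
          ‖∑ σ : Equiv.Perm (Fin n), (cubeChar C (reversed σ) : ℂ) * c (g ∘ σ)‖ ^ 2 : ℝ) : ℂ) := by
  rw [qInner_coordinates q he, Complex.ofReal_sum]
  simp only [← sum_inversions_form]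
  have h1 : (n.factorial : ℂ) = ∑ _σ : Equiv.Perm (Fin n), 1 := by
    simp [Fintype.card_perm]
  -- Substitute `ρ = τ⁻¹ * σ` and replace `g` by `g ∘ τ`; inversion of a permutation preserves the
  -- number of inversions.
  have h2 : ∀ τ : Equiv.Perm (Fin n),
      ∑ ρ : Equiv.Perm (Fin n), (q : ℂ) ^ inversions ρ * ∑ g, conj (c (g ∘ ρ)) * c g
        = ∑ g : Fin n → Fin d, ∑ σ : Equiv.Perm (Fin n),
            (q : ℂ) ^ inversions (σ⁻¹ * τ) * (conj (c (g ∘ σ)) * c (g ∘ τ)) := by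
    intro τ
    rw [Finset.sum_comm, ← Equiv.sum_comp (Equiv.mulLeft τ⁻¹)]
    refine Finset.sum_congr rfl fun σ _ => ?_
    rw [Equiv.coe_mulLeft, ← Finset.mul_sum, ← inversions_inv (τ⁻¹ * σ), mul_inv_rev, inv_inv,
      ← Equiv.sum_comp (Equiv.arrowCongr τ.symm (Equiv.refl (Fin d)))]
    congr 1
    refine Finset.sum_congr rfl fun g _ => ?_
    congr 3
    ext i
    simp
  simp only [h1, Finset.sum_mul, one_mul]
  rw [Finset.sum_congr rfl fun τ _ => h2 τ, Finset.sum_comm]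
  exact Finset.sum_congr rfl fun g _ => Finset.sum_comm

theorem qInner_coordinates_re_nonneg {q : ℝ} (hq₁ : -1 < q) (hq₂ : q < 1) (he : Orthonormal ℂ e)
    (c : (Fin n → Fin d) → ℂ) :
    0 ≤ (qInner q (∑ f, c f • tens (List.ofFn (e ∘ f)))
      (∑ f, c f • tens (List.ofFn (e ∘ f)))).re := by
  have h := congrArg Complex.re (factorial_mul_qInner q he c)
  rw [Complex.ofReal_re, ← Complex.ofReal_natCast, Complex.re_ofReal_mul] at h
  have h1 : (0 : ℝ) < n.factorial := by exact_mod_cast n.factorial_pos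
  refine nonneg_of_mul_nonneg_right (h.symm ▸ ?_) h1
  exact Finset.sum_nonneg fun g _ => Finset.sum_nonneg fun C _ =>
    mul_nonneg (cubeWeight_pos hq₁ hq₂ C).le (sq_nonneg _)

theorem coordinates_eq_zero {q : ℝ} (hq₁ : -1 < q) (hq₂ : q < 1) (he : Orthonormal ℂ e)
    (c : (Fin n → Fin d) → ℂ)
    (h0 : (qInner q (∑ f, c f • tens (List.ofFn (e ∘ f)))
      (∑ f, c f • tens (List.ofFn (e ∘ f)))).re = 0) : c = 0 := by
  have h := congrArg Complex.re (factorial_mul_qInner q he c)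
  rw [Complex.ofReal_re, ← Complex.ofReal_natCast, Complex.re_ofReal_mul, h0, mul_zero] at h
  have hnn : ∀ g : Fin n → Fin d, ∀ C, 0 ≤ cubeWeight q C *
      ‖∑ σ : Equiv.Perm (Fin n), (cubeChar C (reversed σ) : ℂ) * c (g ∘ σ)‖ ^ 2 := fun g C =>
    mul_nonneg (cubeWeight_pos hq₁ hq₂ C).le (sq_nonneg _)
  funext g
  refine eq_zero_of_transform_eq_zero (x := fun σ : Equiv.Perm (Fin n) => c (g ∘ σ))
    (fun C => ?_) 1
  have h2 := (Finset.sum_eq_zero_iff_of_nonneg fun g _ => Finset.sum_nonneg fun C _ => hnn g C).1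
    h.symm g (Finset.mem_univ g)
  have h3 := (Finset.sum_eq_zero_iff_of_nonneg fun C _ => hnn g C).1 h2 C (Finset.mem_univ C)
  simpa [(cubeWeight_pos hq₁ hq₂ C).ne'] using h3

theorem inner₀_coordinates (he : Orthonormal ℂ e) (c : (Fin n → Fin d) → ℂ) :
    inner₀ (∑ f, c f • tens (List.ofFn (e ∘ f))) (∑ f, c f • tens (List.ofFn (e ∘ f)))
      = ((∑ f, ‖c f‖ ^ 2 : ℝ) : ℂ) := by
  have h : ∀ f g : Fin n → Fin d, inner₀ (tens (List.ofFn (e ∘ f))) (tens (List.ofFn (e ∘ g)))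
      = if f = g then 1 else 0 := by
    intro f g
    rw [inner₀_tens_ofFn]
    simp only [Function.comp_apply, orthonormal_iff_ite.1 he, Finset.prod_ite_zero,
      Finset.prod_const_one, Finset.mem_univ, true_implies, funext_iff]
  rw [inner₀_sum_smul]
  simp [h, Complex.conj_mul']

/-- Each of the `n!` permutations has weight at most `1` in modulus and permutes the coordinates, so
it contributes at most `∑ ‖c f‖ ^ 2`. -/
theorem qInner_coordinates_re_le {q : ℝ} (hq₁ : -1 < q) (hq₂ : q < 1) (he : Orthonormal ℂ e)
    (c : (Fin n → Fin d) → ℂ) :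
    (qInner q (∑ f, c f • tens (List.ofFn (e ∘ f)))
      (∑ f, c f • tens (List.ofFn (e ∘ f)))).re ≤ n.factorial * ∑ f, ‖c f‖ ^ 2 := by
  refine (Complex.re_le_norm _).trans ?_
  rw [qInner_coordinates q he]
  have h1 : (n.factorial : ℝ) * ∑ f, ‖c f‖ ^ 2
      = ∑ _σ : Equiv.Perm (Fin n), ∑ f, ‖c f‖ ^ 2 := by simp [Fintype.card_perm]
  rw [h1]
  refine (norm_sum_le _ _).trans (Finset.sum_le_sum fun σ _ => ?_)
  have hq : ‖(q : ℂ) ^ inversions σ‖ ≤ 1 := by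
    rw [norm_pow, Complex.norm_real]
    exact pow_le_one₀ (norm_nonneg _) (abs_le.2 ⟨hq₁.le, hq₂.le⟩)
  rw [norm_mul]
  refine (mul_le_of_le_one_left (norm_nonneg _) hq).trans ((norm_sum_le _ _).trans ?_)
  have h2 : ∑ f, ‖c (f ∘ σ)‖ ^ 2 = ∑ f, ‖c f‖ ^ 2 :=
    Equiv.sum_comp (Equiv.arrowCongr σ.symm (Equiv.refl (Fin d))) fun f => ‖c f‖ ^ 2
  calc ∑ f, ‖conj (c (f ∘ σ)) * c f‖ ≤ ∑ f, (‖c (f ∘ σ)‖ ^ 2 + ‖c f‖ ^ 2) / 2 := by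
        refine Finset.sum_le_sum fun f _ => ?_
        rw [norm_mul, RCLike.norm_conj]
        nlinarith [sq_nonneg (‖c (f ∘ σ)‖ - ‖c f‖)]
    _ = ∑ f, ‖c f‖ ^ 2 := by rw [← Finset.sum_div, Finset.sum_add_distrib, h2]; ring

end Coordinates

theorem qInner_re_le {q : ℝ} (hq₁ : -1 < q) (hq₂ : q < 1) {n : ℕ} {v : Falg H}
    (hv : v ∈ degreePart H n) : (qInner q v v).re ≤ n.factorial * (inner₀ v v).re := by
  obtain ⟨d, e, c, he, rfl⟩ := exists_orthonormal_coordinates hv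
  rw [inner₀_coordinates he, Complex.ofReal_re]
  exact qInner_coordinates_re_le hq₁ hq₂ he c

theorem qInner_eq_zero_of_degree_ne (q : ℝ) {m n : ℕ} (h : m ≠ n) {v w : Falg H}
    (hv : v ∈ degreePart H m) (hw : w ∈ degreePart H n) : qInner q v w = 0 := by
  induction hv, hw using Submodule.span_induction₂ with
  | mem_mem v w hv hw =>
    obtain ⟨ξ, rfl⟩ := hv
    obtain ⟨η, rfl⟩ := hw
    exact qInner_tens_of_ne q h ξ η
  | zero_left | zero_right => simp [← qForm_apply]
  | add_left _ _ _ _ _ _ h1 h2 => rw [← qForm_apply] at *; simp [h1, h2]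
  | add_right _ _ _ _ _ _ h1 h2 => rw [← qForm_apply] at *; simp [h1, h2]
  | smul_left _ _ _ _ _ h1 => rw [← qForm_apply] at *; simp [h1]
  | smul_right _ _ _ _ _ h1 => rw [← qForm_apply] at *; simp [h1]

theorem conj_qInner (q : ℝ) (v w : Falg H) : conj (qInner q w v) = qInner q v w := by
  have key : ∀ {m n : ℕ} {v w : Falg H}, v ∈ degreePart H m → w ∈ degreePart H n →
      conj (qInner q w v) = qInner q v w := by
    intro m n v w hv hw
    induction hv, hw using Submodule.span_induction₂ with
    | mem_mem v w hv hw =>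
      obtain ⟨ξ, rfl⟩ := hv
      obtain ⟨η, rfl⟩ := hw
      exact conj_qInner_tens q ξ η
    | zero_left | zero_right => simp [← qForm_apply]
    | add_left _ _ _ _ _ _ h1 h2 => simp only [← qForm_apply] at *; simp [← h1, ← h2]
    | add_right _ _ _ _ _ _ h1 h2 => simp only [← qForm_apply] at *; simp [← h1, ← h2]
    | smul_left _ _ _ _ _ h1 => simp only [← qForm_apply] at *; simp [← h1]
    | smul_right _ _ _ _ _ h1 => simp only [← qForm_apply] at *; simp [← h1]
  obtain ⟨N, v, hv, rfl⟩ := exists_eq_sum_degreePart v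
  obtain ⟨N', w, hw, rfl⟩ := exists_eq_sum_degreePart w
  simp only [← qForm_apply, map_sum, LinearMap.sum_apply]
  rw [Finset.sum_comm]
  exact Finset.sum_congr rfl fun m _ => Finset.sum_congr rfl fun n _ => key (hv _) (hw _)

theorem qInner_sum_degree (q : ℝ) (N : ℕ) {w : ℕ → Falg H} (hw : ∀ n, w n ∈ degreePart H n) :
    qInner q (∑ n ∈ Finset.range N, w n) (∑ n ∈ Finset.range N, w n)
      = ∑ n ∈ Finset.range N, qInner q (w n) (w n) := by
  simp only [← qForm_apply, map_sum, LinearMap.sum_apply]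
  refine Finset.sum_congr rfl fun n hn => ?_
  exact Finset.sum_eq_single_of_mem n hn fun m _ hmn =>
    qInner_eq_zero_of_degree_ne q hmn (hw m) (hw n)

theorem qInner_degree_re_nonneg {q : ℝ} (hq₁ : -1 < q) (hq₂ : q < 1) {n : ℕ} {v : Falg H}
    (hv : v ∈ degreePart H n) : 0 ≤ (qInner q v v).re := by
  obtain ⟨d, e, c, he, rfl⟩ := exists_orthonormal_coordinates hv
  exact qInner_coordinates_re_nonneg hq₁ hq₂ he c

/-- For `-1 < q < 1`, the `q`-inner product is a (strictly positive definite) inner product. -/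
noncomputable abbrev qCore {q : ℝ} (hq₁ : -1 < q) (hq₂ : q < 1) :
    InnerProductSpace.Core ℂ (Falg H) where
  inner := qInner q
  conj_inner_symm := conj_qInner q
  re_inner_nonneg v := by
    obtain ⟨N, w, hw, rfl⟩ := exists_eq_sum_degreePart v
    rw [qInner_sum_degree q N hw, map_sum]
    exact Finset.sum_nonneg fun n _ => qInner_degree_re_nonneg hq₁ hq₂ (hw n)
  add_left u v w := by simp [← qForm_apply]
  smul_left v w c := by simp [← qForm_apply]
  definite v hv := by
    obtain ⟨N, w, hw, rfl⟩ := exists_eq_sum_degreePart v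
    refine Finset.sum_eq_zero fun n hn => ?_
    have h := congrArg Complex.re hv
    rw [qInner_sum_degree q N hw, Complex.re_sum, Complex.zero_re,
      Finset.sum_eq_zero_iff_of_nonneg fun n _ => qInner_degree_re_nonneg hq₁ hq₂ (hw n)] at h
    obtain ⟨d, e, c, he, hc⟩ := exists_orthonormal_coordinates (hw n)
    have h0 := h n hn
    rw [hc] at h0 ⊢
    rw [coordinates_eq_zero hq₁ hq₂ he c h0]
    simp

/-- The norm of the `q`-Fock space. -/
noncomputable def qNorm (q : ℝ) (v : Falg H) : ℝ := √(qInner q v v).re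

theorem phiNorm_eq (q : ℝ) (A : Module.End ℂ (Falg H)) : phiNorm q A = qNorm q (A 1) := rfl

theorem qNorm_nonneg (q : ℝ) (v : Falg H) : 0 ≤ qNorm q v := Real.sqrt_nonneg _

theorem qNorm_add_le {q : ℝ} (hq₁ : -1 < q) (hq₂ : q < 1) (v w : Falg H) :
    qNorm q (v + w) ≤ qNorm q v + qNorm q w :=
  letI := (qCore (H := H) hq₁ hq₂).toNormedAddCommGroup
  norm_add_le v w

theorem qNorm_sub_le {q : ℝ} (hq₁ : -1 < q) (hq₂ : q < 1) (v w : Falg H) :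
    qNorm q (v - w) ≤ qNorm q v + qNorm q w :=
  letI := (qCore (H := H) hq₁ hq₂).toNormedAddCommGroup
  norm_sub_le v w

theorem qNorm_smul {q : ℝ} (c : ℂ) (v : Falg H) : qNorm q (c • v) = ‖c‖ * qNorm q v := by
  have h : qInner q (c • v) (c • v) = ((‖c‖ ^ 2 : ℝ) : ℂ) * qInner q v v := by
    rw [Complex.ofReal_pow, ← Complex.conj_mul']
    simp [← qForm_apply]
    ring
  rw [qNorm, h, Complex.re_ofReal_mul, Real.sqrt_mul (sq_nonneg _), Real.sqrt_sq (norm_nonneg _),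
    qNorm]

theorem qNorm_eq_zero {q : ℝ} (hq₁ : -1 < q) (hq₂ : q < 1) {v : Falg H} (h : qNorm q v = 0) :
    v = 0 :=
  letI := (qCore (H := H) hq₁ hq₂).toNormedAddCommGroup
  norm_eq_zero.1 h

theorem qNorm_sq {q : ℝ} (hq₁ : -1 < q) (hq₂ : q < 1) (v : Falg H) :
    qNorm q v ^ 2 = (qInner q v v).re :=
  Real.sq_sqrt ((qCore (H := H) hq₁ hq₂).re_inner_nonneg v)

theorem qNorm_sq_sum_of_orthogonal {ι : Type*} {q : ℝ} (hq₁ : -1 < q) (hq₂ : q < 1)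
    (s : Finset ι) (v : ι → Falg H)
    (h : ∀ i ∈ s, ∀ j ∈ s, i ≠ j → qInner q (v i) (v j) = 0) :
    qNorm q (∑ i ∈ s, v i) ^ 2 = ∑ i ∈ s, qNorm q (v i) ^ 2 := by
  simp only [qNorm_sq hq₁ hq₂]
  rw [← Complex.re_sum]
  congr 1
  simp only [← qForm_apply, map_sum, LinearMap.sum_apply]
  refine Finset.sum_congr rfl fun j hj => ?_
  exact Finset.sum_eq_single_of_mem j hj fun i hi hij => h i hi j hj hij

end Positivity

/-! ### The vacuum is separating -/

section Separating

variable {H : Type*} [NormedAddCommGroup H] [InnerProductSpace ℂ H]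

/-- The tensors of degree less than `n`. -/
def lowDegree (H : Type*) [NormedAddCommGroup H] [InnerProductSpace ℂ H] (n : ℕ) :
    Submodule ℂ (Falg H) :=
  Submodule.span ℂ {v | ∃ l : List H, l.length < n ∧ v = tens l}

theorem tens_mem_lowDegree {l : List H} {n : ℕ} (h : l.length < n) : tens l ∈ lowDegree H n :=
  Submodule.subset_span ⟨l, h, rfl⟩

theorem lowDegree_mono {m n : ℕ} (h : m ≤ n) : lowDegree H m ≤ lowDegree H n :=
  Submodule.span_mono fun _ ⟨l, hl, hv⟩ => ⟨l, hl.trans_le h, hv⟩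

theorem annihilation_mem_lowDegree (q : ℝ) (ζ : H) (l : List H) :
    annihilation q ζ (tens l) ∈ lowDegree H (l.length + 1) := by
  rw [annihilation_tens]
  refine Submodule.sum_mem _ fun k _ => Submodule.smul_mem _ _ (tens_mem_lowDegree ?_)
  have := k.isLt
  grind

theorem gauge_mem_lowDegree (q : ℝ) (T : H →ₗ[ℂ] H) (l : List H) :
    gauge q T (tens l) ∈ lowDegree H (l.length + 1) := by
  rw [gauge_tens]
  refine Submodule.sum_mem _ fun k _ => Submodule.smul_mem _ _ (tens_mem_lowDegree ?_)
  have := k.isLt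
  grind

/-- Since `L` does not raise the degree, substituting `a*(f) + L f` for each letter `f` in `P` and
applying the result to the vacuum reproduces `P` up to lower degree. If the outcome is zero, the
leading term of `P` vanishes. -/
theorem eq_zero_of_lift_apply_one_eq_zero {L : H →ₗ[ℂ] Module.End ℂ (Falg H)}
    (hL : ∀ f l, L f (tens l) ∈ lowDegree H (l.length + 1)) {P : Falg H}
    (hP : TensorAlgebra.lift ℂ (LinearMap.mul ℂ (Falg H) ∘ₗ TensorAlgebra.ι ℂ + L) P 1 = 0) :
    P = 0 := by
  set Φ := TensorAlgebra.lift ℂ (LinearMap.mul ℂ (Falg H) ∘ₗ TensorAlgebra.ι ℂ + L) with hΦ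
  have hL' : ∀ (n : ℕ) (f : H), ∀ v ∈ lowDegree H n, L f v ∈ lowDegree H n := by
    intro n f v hv
    induction hv using Submodule.span_induction with
    | mem v hv =>
      obtain ⟨l, hl, rfl⟩ := hv
      exact lowDegree_mono hl (hL f l)
    | zero => simp
    | add u v _ _ hu hv => simpa using add_mem hu hv
    | smul c v _ hv => simpa using Submodule.smul_mem _ c hv
  have hC : ∀ (n : ℕ) (f : H), ∀ v ∈ lowDegree H n,
      TensorAlgebra.ι ℂ f * v ∈ lowDegree H (n + 1) := by
    intro n f v hv
    induction hv using Submodule.span_induction with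
    | mem v hv =>
      obtain ⟨l, hl, rfl⟩ := hv
      rw [← tens_cons]
      exact tens_mem_lowDegree (by simpa using hl)
    | zero => simp
    | add u v _ _ hu hv => simpa [mul_add] using add_mem hu hv
    | smul c v _ hv => simpa using Submodule.smul_mem _ c hv
  have hlead : ∀ l : List H, Φ (tens l) 1 - tens l ∈ lowDegree H l.length := by
    intro l
    induction l with
    | nil => simp [tens]
    | cons f l ih =>
      have h1 : Φ (tens (f :: l)) 1 - tens (f :: l)
          = TensorAlgebra.ι ℂ f * (Φ (tens l) 1 - tens l)
            + (L f (tens l) + L f (Φ (tens l) 1 - tens l)) := by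
        rw [tens_cons, map_mul, Module.End.mul_apply, hΦ, TensorAlgebra.lift_ι_apply, ← hΦ]
        simp only [LinearMap.add_apply, LinearMap.comp_apply, LinearMap.mul_apply', map_sub,
          mul_sub]
        abel
      rw [h1, List.length_cons]
      exact add_mem (hC _ _ _ ih)
        (add_mem (hL f l) (lowDegree_mono (Nat.le_succ _) (hL' _ _ _ ih)))
  have hlead' : ∀ n, ∀ v ∈ lowDegree H (n + 1), Φ v 1 - v ∈ lowDegree H n := by
    intro n v hv
    induction hv using Submodule.span_induction with
    | mem v hv =>
      obtain ⟨l, hl, rfl⟩ := hv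
      exact lowDegree_mono (Nat.lt_succ_iff.1 hl) (hlead l)
    | zero => simp
    | add u v _ _ hu hv =>
      have := add_mem hu hv
      rwa [sub_add_sub_comm, ← LinearMap.add_apply, ← map_add] at this
    | smul c v _ hv =>
      have := Submodule.smul_mem _ c hv
      rwa [smul_sub, ← LinearMap.smul_apply, ← map_smul] at this
  -- Descent: as the image is zero, `P` equals minus its own lower-order error, so its degree bound
  -- drops by one each time.
  have hdesc : ∀ n, P ∈ lowDegree H n → P = 0 := by
    intro n
    induction n with
    | zero => simp [lowDegree]
    | succ n ih =>
      intro h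
      have := hlead' n P h
      rw [hP, zero_sub, neg_mem_iff] at this
      exact ih this
  obtain ⟨N, w, hw, hPw⟩ := exists_eq_sum_degreePart P
  refine hdesc N ?_
  rw [hPw]
  refine Submodule.sum_mem _ fun n hn => ?_
  refine (Submodule.span_le.2 ?_ : degreePart H n ≤ lowDegree H N) (hw n)
  rintro _ ⟨ξ, rfl⟩
  exact tens_mem_lowDegree (by simpa using hn)

/-- An algebra generated by operators `a*(f) + L`, where `L` does not raise the degree and depends
linearly on `f`, has the vacuum as a separating vector. -/
theorem eq_zero_of_mem_adjoin_of_apply_one_eq_zero (G : Set (H × Module.End ℂ (Falg H)))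
    (hlow : ∀ p ∈ G, ∀ l, p.2 (tens l) ∈ lowDegree H (l.length + 1))
    (hG : ∀ p ∈ Submodule.span ℂ G, p.1 = 0 → p.2 = 0) {A : Module.End ℂ (Falg H)}
    (hA : A ∈ Algebra.adjoin ℂ ((fun p => creation p.1 + p.2) '' G)) (h0 : A 1 = 0) : A = 0 := by
  let S := Submodule.span ℂ G
  let F : S →ₗ[ℂ] H := LinearMap.fst ℂ H (Module.End ℂ (Falg H)) ∘ₗ S.subtype
  -- By `hG` the creation vector determines the remaining part on the span. A left inverse of the
  -- projection extends this assignment to a linear map `L` on all of `H`.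
  have hinj : LinearMap.ker F = ⊥ := by
    rw [LinearMap.ker_eq_bot']
    rintro ⟨p, hp⟩ h
    exact Subtype.ext (Prod.ext h (hG p hp h))
  obtain ⟨g, hg⟩ := LinearMap.exists_leftInverse_of_injective (K := ℂ) (V := S) (V' := H) F hinj
  let L : H →ₗ[ℂ] Module.End ℂ (Falg H) := LinearMap.snd ℂ H _ ∘ₗ S.subtype ∘ₗ g
  have hL : ∀ f l, L f (tens l) ∈ lowDegree H (l.length + 1) := by
    intro f l
    have : ∀ p ∈ S, p.2 (tens l) ∈ lowDegree H (l.length + 1) := by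
      intro p hp
      induction hp using Submodule.span_induction with
      | mem p hp => exact hlow p hp l
      | zero => simp
      | add u v _ _ hu hv => simpa using add_mem hu hv
      | smul c v _ hv => simpa using Submodule.smul_mem _ c hv
    exact this _ (g f).2
  have hLG : ∀ p ∈ G, L p.1 = p.2 := by
    intro p hp
    have := LinearMap.congr_fun hg ⟨p, Submodule.subset_span hp⟩
    exact congrArg (fun x : S => (x : H × Module.End ℂ (Falg H)).2) this
  let Φ := TensorAlgebra.lift ℂ (LinearMap.mul ℂ (Falg H) ∘ₗ TensorAlgebra.ι ℂ + L)
  have hrange : Algebra.adjoin ℂ ((fun p => creation p.1 + p.2) '' G) ≤ Φ.range := by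
    refine Algebra.adjoin_le ?_
    rintro _ ⟨p, hp, rfl⟩
    refine ⟨TensorAlgebra.ι ℂ p.1, ?_⟩
    refine (TensorAlgebra.lift_ι_apply _ _).trans ?_
    rw [LinearMap.add_apply, hLG p hp]
    rfl
  obtain ⟨P, rfl⟩ := hrange hA
  have : P = 0 := eq_zero_of_lift_apply_one_eq_zero hL h0
  rw [this]
  exact map_zero Φ

end Separating

/-! ### Calculations with the vectors `χ_[a,b) ⊗ x^k` -/

section Boxes

variable {ν : Measure ℝ}

theorem annihilation_zero {H : Type*} [NormedAddCommGroup H] [InnerProductSpace ℂ H] (q : ℝ) :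
    annihilation q (0 : H) = 0 := by
  simp [annihilation]

theorem annihilation_add {H : Type*} [NormedAddCommGroup H] [InnerProductSpace ℂ H] (q : ℝ)
    (ζ η : H) : annihilation q (ζ + η) = annihilation q ζ + annihilation q η := by
  simp [annihilation, LinearMap.rTensor_add, LinearMap.add_comp, LinearMap.comp_add]

theorem annihilation_smul {H : Type*} [NormedAddCommGroup H] [InnerProductSpace ℂ H] (q : ℝ)
    (c : ℂ) (ζ : H) : annihilation q (c • ζ) = conj c • annihilation q ζ := by
  simp [annihilation, LinearMap.rTensor_smul, LinearMap.smul_comp, LinearMap.comp_smul]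

theorem gauge_zero {H : Type*} [NormedAddCommGroup H] [InnerProductSpace ℂ H] (q : ℝ) :
    gauge q (0 : H →ₗ[ℂ] H) = 0 := by
  simp [gauge]

theorem gauge_add {H : Type*} [NormedAddCommGroup H] [InnerProductSpace ℂ H] (q : ℝ)
    (S T : H →ₗ[ℂ] H) : gauge q (S + T) = gauge q S + gauge q T := by
  simp [gauge, LinearMap.rTensor_add, LinearMap.add_comp, LinearMap.comp_add]

theorem gauge_smul {H : Type*} [NormedAddCommGroup H] [InnerProductSpace ℂ H] (q : ℝ)
    (c : ℂ) (T : H →ₗ[ℂ] H) : gauge q (c • T) = c • gauge q T := by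
  simp [gauge, LinearMap.rTensor_smul, LinearMap.smul_comp, LinearMap.comp_smul]

variable [IsProbabilityMeasure ν]

theorem boxVec_ae (hν : IsCompact ν.support) (a b : ℝ) (k : ℕ) :
    boxVec hν a b k =ᵐ[base ν] box a b k :=
  (memLp_two_box hν a b k).coeFn_toLp

/-- `Y_k([a,b))` is determined by its creation part. -/
theorem snd_eq_zero_of_mem_span (q : ℝ) (hν : IsCompact ν.support)
    {p : OneParticle ν × Op ν}
    (hp : p ∈ Submodule.span ℂ {p | ∃ (k : ℕ) (a b : ℝ), 1 ≤ k ∧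
      p = (boxVec hν a b (k - 1), annihilation q (boxVec hν a b (k - 1))
        + gauge q (boxMul hν a b k))}) (h0 : p.1 = 0) : p.2 = 0 := by
  -- Property stable under linear combinations: the annihilated vector is the conjugate of `p.1`,
  -- and `T` is multiplication by `x * p.1`. The conjugate absorbs the conjugate-linearity of
  -- `annihilation`; on generators it is invisible because `box` is real-valued.
  have key : ∃ (g : OneParticle ν) (T : OneParticle ν →ₗ[ℂ] OneParticle ν),
      p.2 = annihilation q g + gauge q T ∧ (∀ᵐ z ∂(base ν), g z = conj (p.1 z)) ∧
      ∀ f, ∀ᵐ z ∂(base ν), T f z = z.2 * p.1 z * f z := by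
    clear h0
    induction hp using Submodule.span_induction with
    | mem p hp =>
      obtain ⟨k, a, b, hk, rfl⟩ := hp
      refine ⟨_, _, rfl, ?_, fun f => ?_⟩
      · filter_upwards [boxVec_ae hν a b (k - 1)] with z hz
        rw [hz, box, Set.indicator]
        split_ifs <;> simp
      · filter_upwards [boxVec_ae hν a b (k - 1), boxMul_ae hν a b k f] with z hz hz'
        obtain ⟨k, rfl⟩ := Nat.exists_eq_add_of_le' hk
        rw [hz, hz', Nat.add_sub_cancel, box, box, Set.indicator, Set.indicator]
        split_ifs
        · ring
        · simp
    | zero =>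
      refine ⟨0, 0, by simp [annihilation_zero, gauge_zero], ?_, fun f => ?_⟩
      · filter_upwards [Lp.coeFn_zero ℂ 2 (base ν)] with z hz
        rw [Prod.fst_zero, hz]
        simp
      · filter_upwards [Lp.coeFn_zero ℂ 2 (base ν)] with z hz
        rw [Prod.fst_zero, LinearMap.zero_apply, hz]
        simp
    | add p p' _ _ h h' =>
      obtain ⟨g, T, h1, h2, h3⟩ := h
      obtain ⟨g', T', h1', h2', h3'⟩ := h'
      refine ⟨g + g', T + T', ?_, ?_, fun f => ?_⟩
      · rw [annihilation_add, gauge_add, Prod.snd_add, h1, h1']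
        abel
      · filter_upwards [h2, h2', Lp.coeFn_add g g', Lp.coeFn_add p.1 p'.1] with z e1 e2 e3 e4
        rw [Prod.fst_add, e3, e4, Pi.add_apply, Pi.add_apply, e1, e2, map_add]
      · filter_upwards [h3 f, h3' f, Lp.coeFn_add (T f) (T' f), Lp.coeFn_add p.1 p'.1]
          with z e1 e2 e3 e4
        rw [Prod.fst_add, LinearMap.add_apply, e3, e4, Pi.add_apply, Pi.add_apply, e1, e2]
        ring
    | smul c p _ h =>
      obtain ⟨g, T, h1, h2, h3⟩ := h
      refine ⟨conj c • g, c • T, ?_, ?_, fun f => ?_⟩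
      · rw [annihilation_smul, gauge_smul, Prod.smul_snd, h1, Complex.conj_conj, smul_add]
      · filter_upwards [h2, Lp.coeFn_smul (conj c) g, Lp.coeFn_smul c p.1] with z e1 e2 e3
        rw [Prod.smul_fst, e2, e3, Pi.smul_apply, Pi.smul_apply, e1, smul_eq_mul, smul_eq_mul,
          map_mul]
      · filter_upwards [h3 f, Lp.coeFn_smul c (T f), Lp.coeFn_smul c p.1] with z e1 e2 e3
        rw [Prod.smul_fst, LinearMap.smul_apply, e2, e3, Pi.smul_apply, Pi.smul_apply, e1,
          smul_eq_mul, smul_eq_mul]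
        ring
  obtain ⟨g, T, h1, h2, h3⟩ := key
  rw [h0] at h2 h3
  have hg : g = 0 := by
    refine Lp.ext ?_
    filter_upwards [h2, Lp.coeFn_zero ℂ 2 (base ν)] with z e1 e2
    rw [e1, e2]
    simp
  have hT : T = 0 := by
    refine LinearMap.ext fun f => Lp.ext ?_
    filter_upwards [h3 f, Lp.coeFn_zero ℂ 2 (base ν)] with z e1 e2
    rw [e1, LinearMap.zero_apply, e2]
    simp
  rw [h1, hg, hT, annihilation_zero, gauge_zero, add_zero]

/-- The vacuum is separating for the algebra generated by all `Y_k([a,b))`. -/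
theorem eq_zero_of_mem_algXΔ {q : ℝ} {hν : IsCompact ν.support} {A : Op ν} (hA : A ∈ algXΔ q hν)
    (h0 : A 1 = 0) : A = 0 := by
  refine eq_zero_of_mem_adjoin_of_apply_one_eq_zero _ ?_
    (fun p => snd_eq_zero_of_mem_span q hν) (Algebra.adjoin_mono ?_ hA) h0
  · rintro _ ⟨k, a, b, _, rfl⟩ l
    exact add_mem (annihilation_mem_lowDegree _ _ _) (gauge_mem_lowDegree _ _ _)
  · rintro _ ⟨k, a, b, hk, -, -, rfl⟩
    refine ⟨_, ⟨k, a, b, hk, rfl⟩, ?_⟩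
    simp only [Y, fieldOp]
    abel

theorem eq_of_apply_one_eq {q : ℝ} {hν : IsCompact ν.support} {A B : Op ν} (hA : A ∈ algXΔ q hν)
    (hB : B ∈ algXΔ q hν) (h : A 1 = B 1) : A = B :=
  sub_eq_zero.1 (eq_zero_of_mem_algXΔ (sub_mem hA hB) (by simp [h]))

/-- The Lebesgue measure of `[a,b) ∩ ℝ₊`. -/
noncomputable def len (a b : ℝ) : ℝ := (volume.restrict (Set.Ici (0 : ℝ))).real (Set.Ico a b)

theorem len_eq {a b : ℝ} (ha : 0 ≤ a) (hab : a ≤ b) : len a b = b - a := by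
  rw [len, measureReal_restrict_apply measurableSet_Ico, Set.inter_eq_left.2, Real.volume_real_Ico_of_le hab]
  exact fun x hx => ha.trans hx.1

theorem inner_boxVec (hν : IsCompact ν.support) (a b a' b' : ℝ) (k m : ℕ) :
    inner ℂ (boxVec hν a b k) (boxVec hν a' b' m)
      = (volume.restrict (Set.Ici (0 : ℝ))).real (Set.Ico a b ∩ Set.Ico a' b')
        * ((∫ x, x ^ (k + m) ∂ν : ℝ) : ℂ) := by
  rw [L2.inner_def]
  have h : ∀ᵐ z ∂(base ν), inner ℂ (boxVec hν a b k z) (boxVec hν a' b' m z)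
      = (Set.Ico a b ∩ Set.Ico a' b').indicator (fun _ => (1 : ℂ)) z.1 * ((z.2 ^ (k + m) : ℝ) : ℂ) := by
    filter_upwards [boxVec_ae hν a b k, boxVec_ae hν a' b' m] with z h1 h2
    rw [h1, h2, box, box]
    by_cases ha : z.1 ∈ Set.Ico a b <;> by_cases hb : z.1 ∈ Set.Ico a' b' <;>
      simp [Set.indicator, ha, hb, -Set.mem_Ico, pow_add, mul_comm]
  rw [integral_congr_ae h, integral_prod_mul
    ((Set.Ico a b ∩ Set.Ico a' b').indicator fun _ => (1 : ℂ)) fun x => ((x ^ (k + m) : ℝ) : ℂ),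
    integral_indicator_const _ (measurableSet_Ico.inter measurableSet_Ico), Complex.real_smul,
    mul_one]
  congr 1
  exact integral_ofReal

theorem inner_boxVec_self (hν : IsCompact ν.support) (a b : ℝ) (k m : ℕ) :
    inner ℂ (boxVec hν a b k) (boxVec hν a b m)
      = ((len a b * ∫ x, x ^ (k + m) ∂ν : ℝ) : ℂ) := by
  rw [inner_boxVec, Set.inter_self, len, Complex.ofReal_mul]

theorem inner_boxVec_of_disjoint (hν : IsCompact ν.support) {a b a' b' : ℝ} (k m : ℕ)
    (h : Disjoint (Set.Ico a b) (Set.Ico a' b')) :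
    inner ℂ (boxVec hν a b k) (boxVec hν a' b' m) = 0 := by
  rw [inner_boxVec, Set.disjoint_iff_inter_eq_empty.1 h]
  simp

theorem boxMul_boxVec_self (hν : IsCompact ν.support) (a b : ℝ) (k m : ℕ) :
    boxMul hν a b k (boxVec hν a b m) = boxVec hν a b (k + m) := by
  refine Lp.ext ?_
  filter_upwards [boxMul_ae hν a b k (boxVec hν a b m), boxVec_ae hν a b m,
    boxVec_ae hν a b (k + m)] with z h1 h2 h3
  rw [h1, h2, h3, box, box, box]
  by_cases ha : z.1 ∈ Set.Ico a b <;> simp [Set.indicator, ha, -Set.mem_Ico, pow_add]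

theorem boxMul_boxVec_of_disjoint (hν : IsCompact ν.support) {a b a' b' : ℝ} (k m : ℕ)
    (h : Disjoint (Set.Ico a b) (Set.Ico a' b')) :
    boxMul hν a b k (boxVec hν a' b' m) = 0 := by
  refine Lp.ext ?_
  filter_upwards [boxMul_ae hν a b k (boxVec hν a' b' m), boxVec_ae hν a' b' m,
    Lp.coeFn_zero ℂ 2 (base ν)] with z h1 h2 h3
  rw [h1, h2, h3, box, box]
  by_cases ha : z.1 ∈ Set.Ico a b
  · simp [Set.indicator_of_notMem (Set.disjoint_left.1 h ha)]
  · simp [Set.indicator_of_notMem ha]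

theorem boxVec_add (hν : IsCompact ν.support) {a b c : ℝ} (hab : a ≤ b) (hbc : b ≤ c) (k : ℕ) :
    boxVec hν a b k + boxVec hν b c k = boxVec hν a c k := by
  refine Lp.ext ?_
  filter_upwards [boxVec_ae hν a b k, boxVec_ae hν b c k, boxVec_ae hν a c k,
    Lp.coeFn_add (boxVec hν a b k) (boxVec hν b c k)] with z h1 h2 h3 h4
  rw [h4, Pi.add_apply, h1, h2, h3, box, box, box, ← Set.Ico_union_Ico_eq_Ico hab hbc,
    Set.indicator_union_of_disjoint (Set.Ico_disjoint_Ico_same (a := a) (b := b) (c := c))]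

theorem boxVec_empty (hν : IsCompact ν.support) (a : ℝ) (k : ℕ) : boxVec hν a a k = 0 := by
  have := boxVec_add hν (le_refl a) (le_refl a) k
  simpa using this

omit [IsProbabilityMeasure ν] in
theorem boxMul_empty (hν : IsCompact ν.support) (a : ℝ) (k : ℕ) : boxMul hν a a k = 0 := by
  refine LinearMap.ext fun f => Lp.ext ?_
  filter_upwards [boxMul_ae hν a a k f, Lp.coeFn_zero ℂ 2 (base ν)] with z h1 h2
  rw [h1, LinearMap.zero_apply, h2, box]
  simp

theorem Y_empty (q : ℝ) (hν : IsCompact ν.support) (k : ℕ) (a : ℝ) : Y q hν k a a = 0 := by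
  rw [Y, fieldOp, boxVec_empty, boxMul_empty, annihilation_zero, gauge_zero, creation]
  simp

theorem Y_mem_algXΔ (q : ℝ) (hν : IsCompact ν.support) {k : ℕ} (hk : 1 ≤ k) {a b : ℝ}
    (ha : 0 ≤ a) (hab : a ≤ b) : Y q hν k a b ∈ algXΔ q hν := by
  rcases hab.eq_or_lt with rfl | h
  · rw [Y_empty]
    exact zero_mem _
  · exact Algebra.subset_adjoin ⟨k, a, b, hk, ha, h, rfl⟩

end Boxes

/-! ### The diagonal measures -/

section Diagonal

variable {ν : Measure ℝ} [IsProbabilityMeasure ν]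

theorem Subdivision.nonneg {t : ℝ} (I : Subdivision t) (i : Fin (I.N + 1)) : 0 ≤ I.s i :=
  I.first ▸ I.strictMono.monotone (Fin.zero_le i)

theorem Subdivision.lt {t : ℝ} (I : Subdivision t) (i : Fin I.N) :
    I.s i.castSucc < I.s i.succ :=
  I.strictMono Fin.castSucc_lt_succ

theorem Subdivision.sum_sub {t : ℝ} (I : Subdivision t) {M : Type*} [AddCommGroup M]
    (f : ℝ → M) : ∑ i : Fin I.N, (f (I.s i.succ) - f (I.s i.castSucc)) = f t - f 0 := by
  have h : ∀ (N : ℕ) (s : Fin (N + 1) → ℝ),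
      ∑ i : Fin N, (f (s i.succ) - f (s i.castSucc)) = f (s (Fin.last N)) - f (s 0) := by
    intro N
    induction N with
    | zero => simp
    | succ N ih =>
      intro s
      rw [Fin.sum_univ_castSucc]
      have := ih fun i => s i.castSucc
      simp only [Fin.succ_castSucc, this, Fin.succ_last, Fin.castSucc_zero]
      abel
  rw [h, I.first, I.last]

theorem Subdivision.sum_len {t : ℝ} (I : Subdivision t) :
    ∑ i : Fin I.N, len (I.s i.castSucc) (I.s i.succ) = t := by
  have := I.sum_sub fun x => x
  rw [sub_zero] at this
  exact (Finset.sum_congr rfl fun i _ => len_eq (I.nonneg _) (I.lt i).le).trans this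

theorem Subdivision.disjoint {t : ℝ} (I : Subdivision t) {i j : Fin I.N} (hij : i ≠ j) :
    Disjoint (Set.Ico (I.s i.castSucc) (I.s i.succ)) (Set.Ico (I.s j.castSucc) (I.s j.succ)) := by
  wlog h : i < j generalizing i j
  · exact (this hij.symm (lt_of_le_of_ne (not_lt.1 h) hij.symm)).symm
  · refine Set.disjoint_left.2 fun x hx hx' => ?_
    have : I.s i.succ ≤ I.s j.castSucc := I.strictMono.monotone (Fin.succ_le_castSucc_iff.2 h)
    exact absurd (hx.2.trans_le (this.trans hx'.1)) (lt_irrefl _)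

theorem Subdivision.sum_boxVec {t : ℝ} (I : Subdivision t) (hν : IsCompact ν.support) (k : ℕ) :
    ∑ i : Fin I.N, boxVec hν (I.s i.castSucc) (I.s i.succ) k = boxVec hν 0 t k := by
  have := I.sum_sub fun x => boxVec hν 0 x k
  rw [boxVec_empty, sub_zero] at this
  rw [← this]
  exact Finset.sum_congr rfl fun i _ =>
    eq_sub_of_add_eq' (boxVec_add hν (I.nonneg _) (I.lt i).le k)

/-- The subdivision of `[0,t)` into `N` intervals of equal length. -/
noncomputable def Subdivision.uniform {t : ℝ} (ht : 0 < t) (N : ℕ) (hN : 0 < N) :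
    Subdivision t where
  N := N
  s i := i * (t / N)
  strictMono i j h := by
    have : (0 : ℝ) < t / N := by positivity
    have h' : ((i : ℕ) : ℝ) < (j : ℕ) := by exact_mod_cast h
    exact mul_lt_mul_of_pos_right h' this
  first := by simp
  last := by
    have : (N : ℝ) ≠ 0 := by positivity
    simp only [Fin.val_last]
    field_simp

theorem Subdivision.exists_lt {t δ : ℝ} (ht : 0 ≤ t) (hδ : 0 < δ) :
    ∃ I : Subdivision t, ∀ i : Fin I.N, I.s i.succ - I.s i.castSucc < δ := by
  rcases ht.eq_or_lt with rfl | ht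
  · exact ⟨⟨0, 0, fun i j h => by omega, rfl, rfl⟩, fun i => i.elim0⟩
  · obtain ⟨N, hN⟩ := exists_nat_gt (t / δ)
    have hN0 : 0 < N := by
      have : (0 : ℝ) < N := (by positivity : 0 < t / δ).trans hN
      exact_mod_cast this
    refine ⟨Subdivision.uniform ht N hN0, fun i => ?_⟩
    have h1 : (Subdivision.uniform ht N hN0).s i.succ - (Subdivision.uniform ht N hN0).s i.castSucc
        = t / N := by
      change (((i : ℕ) + 1 : ℕ) : ℝ) * (t / N) - ((i : ℕ) : ℝ) * (t / N) = t / N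
      push_cast
      ring
    rw [h1, div_lt_iff₀ (by exact_mod_cast hN0)]
    rwa [div_lt_iff₀ hδ, mul_comm] at hN

/-- The numbers `r_(k+1)`: `r_1 = 0` and `r_(k+2)` is the `k`-th moment of `ν`. -/
noncomputable def cumulant (ν : Measure ℝ) : ℕ → ℝ
  | 0 => 0
  | k + 1 => ∫ x, x ^ k ∂ν

/-- The operator `Δ_(k+1)(t)`. -/
noncomputable def diag (q : ℝ) (hν : IsCompact ν.support) (k : ℕ) (t : ℝ) : Op ν :=
  Y q hν (k + 1) 0 t + ((t * cumulant ν k : ℝ) : ℂ) • 1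

theorem diag_mem_algXΔ (q : ℝ) (hν : IsCompact ν.support) (k : ℕ) {t : ℝ} (ht : 0 ≤ t) :
    diag q hν k t ∈ algXΔ q hν :=
  add_mem (Y_mem_algXΔ q hν (Nat.le_add_left 1 k) le_rfl ht) (Subalgebra.smul_mem _ (one_mem _) _)

/-- On tensors over one interval the operators obey the Kailath–Segall recursion: creation prepends,
annihilation yields moments times the length, gauge merges two entries. The exponent `m` stands for
the index `m + 1`, which explains the extra `1` in the merged exponents. -/
theorem Y_tens (q : ℝ) (hν : IsCompact ν.support) (k : ℕ) (a b : ℝ) (u : List ℕ) :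
    Y q hν (k + 1) a b (tens (u.map (boxVec hν a b)))
      = tens ((k :: u).map (boxVec hν a b))
        + (∑ i : Fin u.length, ((q ^ (i : ℕ) * (len a b * cumulant ν (k + u[i] + 1)) : ℝ) : ℂ)
            • tens ((u.eraseIdx i).map (boxVec hν a b))
          + ∑ i : Fin u.length, ((q ^ (i : ℕ) : ℝ) : ℂ)
            • tens (((k + 1 + u[i]) :: u.eraseIdx i).map (boxVec hν a b))) := by
  have e : (u.map (boxVec hν a b)).length = u.length := List.length_map _
  rw [Y, fieldOp, LinearMap.add_apply, LinearMap.add_apply, annihilation_tens, gauge_tens,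
    creation, LinearMap.mulLeft_apply, ← tens_cons, Nat.add_sub_cancel, List.map_cons,
    add_comm (Finset.sum _ _), add_assoc]
  congr 2
  · rw [← Equiv.sum_comp (finCongr e.symm)]
    refine Finset.sum_congr rfl fun i _ => ?_
    simp only [finCongr_apply, Fin.val_cast, Fin.getElem_fin, List.getElem_map,
      inner_boxVec_self, List.eraseIdx_map, cumulant]
    push_cast
    rfl
  · rw [← Equiv.sum_comp (finCongr e.symm)]
    refine Finset.sum_congr rfl fun i _ => ?_
    simp only [finCongr_apply, Fin.val_cast, Fin.getElem_fin, List.getElem_map,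
      boxMul_boxVec_self, List.eraseIdx_map, List.map_cons]
    push_cast
    rfl

theorem tens_nil {H : Type*} [NormedAddCommGroup H] [InnerProductSpace ℂ H] :
    tens ([] : List H) = 1 := rfl

theorem Y_one (q : ℝ) (hν : IsCompact ν.support) (k : ℕ) (a b : ℝ) :
    Y q hν (k + 1) a b 1 = tens [boxVec hν a b k] := by
  simpa [tens_nil] using Y_tens q hν k a b []

theorem diag_one (q : ℝ) (hν : IsCompact ν.support) (k : ℕ) (t : ℝ) :
    diag q hν k t 1 = tens [boxVec hν 0 t k] + ((t * cumulant ν k : ℝ) : ℂ) • 1 := by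
  rw [diag, LinearMap.add_apply, Y_one]
  rfl

theorem Y_singleton (q : ℝ) (hν : IsCompact ν.support) (k m : ℕ) (a b : ℝ) :
    Y q hν (k + 1) a b (tens [boxVec hν a b m])
      = tens [boxVec hν a b k, boxVec hν a b m]
        + (((len a b * cumulant ν (k + m + 1) : ℝ) : ℂ) • 1 + tens [boxVec hν a b (k + 1 + m)]) := by
  refine (Y_tens q hν k a b [m]).trans ?_
  congr 2
  · exact (Fin.sum_univ_one _).trans (by simp [tens_nil])
  · exact (Fin.sum_univ_one _).trans (by simp)

/-- The span of the functions `[a,b) ↦ |[a,b)|^p ⊗ᵢ (χ_[a,b) ⊗ x^(u i))` of order at least `2`,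
where `|[a,b)|` has order `2` and each tensor factor has order `1`, without `|[a,b)| Ω`. -/
noncomputable def higherOrder (hν : IsCompact ν.support) : Submodule ℂ (ℝ → ℝ → Falg (OneParticle ν)) :=
  Submodule.span ℂ {R | ∃ (p : ℕ) (u : List ℕ), 2 ≤ 2 * p + u.length ∧ (u = [] → 2 ≤ p) ∧
    R = fun a b => ((len a b ^ p : ℝ) : ℂ) • tens (u.map (boxVec hν a b))}

theorem higherOrder_mk (hν : IsCompact ν.support) (p : ℕ) (u : List ℕ)
    (h : 2 ≤ 2 * p + u.length) (h' : u = [] → 2 ≤ p) :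
    (fun a b => ((len a b ^ p : ℝ) : ℂ) • tens (u.map (boxVec hν a b))) ∈ higherOrder hν :=
  Submodule.subset_span ⟨p, u, h, h', rfl⟩

/-- Order never decreases: creation adds one, annihilation trades a factor of order one for a length
of order two, and gauge preserves the order. -/
theorem X_apply_higherOrder (q : ℝ) (hν : IsCompact ν.support)
    {R : ℝ → ℝ → Falg (OneParticle ν)} (hR : R ∈ higherOrder hν) :
    (fun a b => X q hν a b (R a b)) ∈ higherOrder hν := by
  induction hR using Submodule.span_induction with
  | mem R hR =>
    obtain ⟨p, u, h, h', rfl⟩ := hR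
    have he : (fun a b => X q hν a b (((len a b ^ p : ℝ) : ℂ) • tens (u.map (boxVec hν a b))))
        = (fun a b => ((len a b ^ p : ℝ) : ℂ) • tens ((0 :: u).map (boxVec hν a b)))
          + (∑ i : Fin u.length, ((q ^ (i : ℕ) * cumulant ν (0 + u[i] + 1) : ℝ) : ℂ) •
              (fun a b => ((len a b ^ (p + 1) : ℝ) : ℂ)
                • tens ((u.eraseIdx i).map (boxVec hν a b)))
            + ∑ i : Fin u.length, ((q ^ (i : ℕ) : ℝ) : ℂ) •
              (fun a b => ((len a b ^ p : ℝ) : ℂ)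
                • tens (((0 + 1 + u[i]) :: u.eraseIdx i).map (boxVec hν a b)))) := by
      funext a b
      rw [X, map_smul, Y_tens]
      simp only [Pi.add_apply, Finset.sum_apply, Pi.smul_apply, smul_add, Finset.smul_sum,
        smul_smul]
      congr 2
      · refine Finset.sum_congr rfl fun i _ => ?_
        congr 1
        push_cast
        ring
      · refine Finset.sum_congr rfl fun i _ => ?_
        congr 1
        push_cast
        ring
    rw [he]
    refine add_mem (higherOrder_mk hν _ _ ?_ ?_) (add_mem
      (Submodule.sum_mem _ fun i _ => Submodule.smul_mem _ _ (higherOrder_mk hν _ _ ?_ ?_))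
      (Submodule.sum_mem _ fun i _ => Submodule.smul_mem _ _ (higherOrder_mk hν _ _ ?_ ?_)))
    · simp only [List.length_cons]
      omega
    · simp
    · rw [List.length_eraseIdx_of_lt i.isLt]
      omega
    -- The excluded term `|[a,b)| Ω` could only come from annihilating a lone factor with `p = 0`,
    -- whose order is `1`; here a lone factor comes with `p ≥ 1`.
    · intro h0
      have h1 := congrArg List.length h0
      rw [List.length_eraseIdx_of_lt i.isLt, List.length_nil] at h1
      omega
    · rw [List.length_cons, List.length_eraseIdx_of_lt i.isLt]
      have := i.isLt
      omega
    · simp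
  | zero =>
    have : (fun a b => X q hν a b ((0 : ℝ → ℝ → Falg (OneParticle ν)) a b)) = 0 := by
      funext a b
      simp
    rw [this]
    exact zero_mem _
  | add R R' _ _ h h' =>
    have := add_mem h h'
    convert this using 1
    funext a b
    simp
  | smul c R _ h =>
    have := Submodule.smul_mem _ c h
    convert this using 1
    funext a b
    simp

/-- One more `X` acts on the single tensor by gauge, raising the exponent, and by annihilation,
producing the next moment. The created two-fold tensor, and the length times a one-fold tensor, join
the remainder. -/
theorem exists_X_pow_apply_one (q : ℝ) (hν : IsCompact ν.support) (k : ℕ) :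
    ∃ R ∈ higherOrder hν, ∀ a b, (X q hν a b ^ (k + 1)) 1
      = tens [boxVec hν a b k] + ((len a b * cumulant ν k : ℝ) : ℂ) • 1 + R a b := by
  induction k with
  | zero =>
    refine ⟨0, zero_mem _, fun a b => ?_⟩
    rw [zero_add, pow_one, X, Y_one]
    simp [cumulant]
  | succ k ih =>
    obtain ⟨R, hR, h⟩ := ih
    refine ⟨(fun a b => ((len a b ^ 0 : ℝ) : ℂ) • tens ([0, k].map (boxVec hν a b)))
      + ((cumulant ν k : ℝ) : ℂ) •
        (fun a b => ((len a b ^ 1 : ℝ) : ℂ) • tens ([0].map (boxVec hν a b)))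
      + fun a b => X q hν a b (R a b), ?_, fun a b => ?_⟩
    · exact add_mem (add_mem (higherOrder_mk hν 0 [0, k] (by simp) (by simp))
        (Submodule.smul_mem _ _ (higherOrder_mk hν 1 [0] (by simp) (by simp))))
        (X_apply_higherOrder q hν hR)
    · rw [pow_succ', Module.End.mul_apply, h, map_add, map_add, map_smul]
      have h1 := Y_singleton q hν 0 k a b
      have h2 := Y_one q hν 0 a b
      simp only [zero_add] at h1 h2
      simp only [X, h1, h2, Pi.add_apply, Pi.smul_apply, pow_zero, pow_one, Complex.ofReal_one,
        one_smul, List.map_cons, List.map_nil, smul_smul, add_comm 1 k]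
      rw [← Complex.ofReal_mul, mul_comm (cumulant ν k)]
      abel

/-- The sums of `R` over fine subdivisions of `[0,t)` are small. -/
def Negligible (q : ℝ) (t : ℝ) (R : ℝ → ℝ → Falg (OneParticle ν)) : Prop :=
  ∀ ε > 0, ∃ δ > 0, ∀ I : Subdivision t,
    (∀ i : Fin I.N, I.s i.succ - I.s i.castSucc < δ) →
      qNorm q (∑ i : Fin I.N, R (I.s i.castSucc) (I.s i.succ)) < ε

theorem qNorm_zero {H : Type*} [NormedAddCommGroup H] [InnerProductSpace ℂ H] (q : ℝ) :
    qNorm q (0 : Falg H) = 0 := by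
  simp [qNorm, ← qForm_apply]

omit [IsProbabilityMeasure ν] in
theorem Negligible.zero (q t : ℝ) : Negligible (ν := ν) q t 0 :=
  fun ε hε => ⟨1, one_pos, fun I _ => by simpa [qNorm_zero] using hε⟩

omit [IsProbabilityMeasure ν] in
theorem Negligible.add {q t : ℝ} (hq₁ : -1 < q) (hq₂ : q < 1)
    {R R' : ℝ → ℝ → Falg (OneParticle ν)} (h : Negligible q t R) (h' : Negligible q t R') :
    Negligible q t (R + R') := by
  intro ε hε
  obtain ⟨δ, hδ, H⟩ := h (ε / 2) (half_pos hε)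
  obtain ⟨δ', hδ', H'⟩ := h' (ε / 2) (half_pos hε)
  refine ⟨min δ δ', lt_min hδ hδ', fun I hI => ?_⟩
  simp only [Pi.add_apply, Finset.sum_add_distrib]
  have h1 := H I fun i => (hI i).trans_le (min_le_left _ _)
  have h2 := H' I fun i => (hI i).trans_le (min_le_right _ _)
  linarith [qNorm_add_le hq₁ hq₂ (∑ i : Fin I.N, R (I.s i.castSucc) (I.s i.succ))
    (∑ i : Fin I.N, R' (I.s i.castSucc) (I.s i.succ))]

omit [IsProbabilityMeasure ν] in
theorem Negligible.smul {q t : ℝ} (c : ℂ) {R : ℝ → ℝ → Falg (OneParticle ν)}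
    (h : Negligible q t R) : Negligible q t (c • R) := by
  intro ε hε
  obtain ⟨δ, hδ, H⟩ := h (ε / (‖c‖ + 1)) (by positivity)
  refine ⟨δ, hδ, fun I hI => ?_⟩
  have h1 := H I hI
  simp only [Pi.smul_apply, ← Finset.smul_sum]
  rw [qNorm_smul]
  rw [lt_div_iff₀ (by positivity)] at h1
  nlinarith [qNorm_nonneg q (∑ i : Fin I.N, R (I.s i.castSucc) (I.s i.succ))]

theorem qInner_tens_boxVec_of_disjoint (q : ℝ) (hν : IsCompact ν.support) {a b a' b' : ℝ}
    (h : Disjoint (Set.Ico a b) (Set.Ico a' b')) {u : List ℕ} (hu : u ≠ []) :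
    qInner q (tens (u.map (boxVec hν a b))) (tens (u.map (boxVec hν a' b'))) = 0 := by
  have e : ∀ a b, u.map (boxVec hν a b) = List.ofFn fun i => boxVec hν a b (u.get i) := by
    intro a b
    rw [← Function.comp_def, ← List.map_ofFn, List.ofFn_get]
  rw [e, e, qInner_tens]
  refine Finset.sum_eq_zero fun σ _ => ?_
  have : NeZero u.length := ⟨by simpa using hu⟩
  rw [Finset.prod_eq_zero (Finset.mem_univ 0) (inner_boxVec_of_disjoint hν _ _ h), mul_zero]

/-- Each factor of the inner product contributes one length; the constant involves only `q` and
moments of `ν`. -/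
theorem exists_qInner_tens_boxVec (q : ℝ) (hν : IsCompact ν.support) (u : List ℕ) :
    ∃ C : ℝ, ∀ a b, (qInner q (tens (u.map (boxVec hν a b))) (tens (u.map (boxVec hν a b)))).re
      = len a b ^ u.length * C := by
  have e : ∀ a b, u.map (boxVec hν a b) = List.ofFn fun i => boxVec hν a b (u.get i) := by
    intro a b
    rw [← Function.comp_def, ← List.map_ofFn, List.ofFn_get]
  refine ⟨∑ σ : Equiv.Perm (Fin u.length),
    q ^ inversions σ * ∏ i, ∫ x, x ^ (u.get i + u.get (σ i)) ∂ν, fun a b => ?_⟩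
  rw [e, qInner_tens]
  simp only [inner_boxVec_self, ← Complex.ofReal_prod, ← Complex.ofReal_pow, ← Complex.ofReal_mul,
    ← Complex.ofReal_sum, Complex.ofReal_re, Finset.prod_mul_distrib, Finset.prod_const,
    Finset.card_univ, Fintype.card_fin, Finset.mul_sum]
  exact Finset.sum_congr rfl fun σ _ => by ring

theorem len_nonneg (a b : ℝ) : 0 ≤ len a b := measureReal_nonneg

theorem pow_le_mul_of_two_le {x δ : ℝ} (hx : 0 ≤ x) (hxδ : x ≤ δ) (hδ : δ ≤ 1) {n : ℕ}
    (hn : 2 ≤ n) : x ^ n ≤ δ * x :=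
  calc x ^ n ≤ x ^ 2 := pow_le_pow_of_le_one hx (hxδ.trans hδ) hn
    _ = x * x := sq x
    _ ≤ δ * x := mul_le_mul_of_nonneg_right hxδ hx

/-- Nontrivial tensors over disjoint intervals are orthogonal, so squared norms add, and each is a
constant times a power at least `2` of the length. Multiples of the vacuum do not benefit from
orthogonality and need `p ≥ 2`. In both cases the sum is at most mesh times `t` times a constant. -/
theorem negligible_of_mem_higherOrder {q t : ℝ} (hq₁ : -1 < q) (hq₂ : q < 1) (ht : 0 ≤ t)
    (hν : IsCompact ν.support) {R : ℝ → ℝ → Falg (OneParticle ν)} (hR : R ∈ higherOrder hν) :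
    Negligible q t R := by
  induction hR using Submodule.span_induction with
  | zero => exact Negligible.zero q t
  | add R R' _ _ h h' => exact h.add hq₁ hq₂ h'
  | smul c R _ h => exact h.smul c
  | mem R hR =>
    obtain ⟨p, u, h, h', rfl⟩ := hR
    have hlen : ∀ {δ : ℝ} (I : Subdivision t), (∀ i : Fin I.N, I.s i.succ - I.s i.castSucc < δ) →
        ∀ i : Fin I.N, len (I.s i.castSucc) (I.s i.succ) ≤ δ := by
      intro δ I hI i
      rw [len_eq (I.nonneg _) (I.lt i).le]
      exact (hI i).le
    intro ε hε
    by_cases hu : u = []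
    · subst hu
      let K := qNorm q (1 : Falg (OneParticle ν))
      have hK : 0 ≤ K := qNorm_nonneg _ _
      have hd : 0 < min 1 (ε / (t * K + 1)) := by positivity
      refine ⟨_, hd, fun I hI => ?_⟩
      set δ := min 1 (ε / (t * K + 1)) with hδ
      simp only [List.map_nil, tens_nil, ← Finset.sum_smul]
      rw [qNorm_smul, ← Complex.ofReal_sum, Complex.norm_real,
        Real.norm_of_nonneg (Finset.sum_nonneg fun i _ => pow_nonneg (len_nonneg _ _) _)]
      have h1 : ∑ i : Fin I.N, len (I.s i.castSucc) (I.s i.succ) ^ p ≤ δ * t := by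
        conv_rhs => rw [← I.sum_len, Finset.mul_sum]
        exact Finset.sum_le_sum fun i _ => pow_le_mul_of_two_le (len_nonneg _ _) (hlen I hI i)
          (min_le_left _ _) (h' rfl)
      have h2 : δ * (t * K + 1) ≤ ε := by
        rw [← le_div_iff₀ (by positivity)]
        exact min_le_right _ _
      have h3 := mul_le_mul_of_nonneg_right h1 hK
      change _ * K < ε
      nlinarith
    · obtain ⟨C, hC⟩ := exists_qInner_tens_boxVec q hν u
      have hd : 0 < min 1 (ε ^ 2 / (t * |C| + 1)) := by positivity
      refine ⟨_, hd, fun I hI => ?_⟩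
      set δ := min 1 (ε ^ 2 / (t * |C| + 1)) with hδ
      refine lt_of_pow_lt_pow_left₀ 2 hε.le ?_
      rw [qNorm_sq_sum_of_orthogonal hq₁ hq₂]
      · have h1 : ∀ i : Fin I.N, qNorm q (((len (I.s i.castSucc) (I.s i.succ) ^ p : ℝ) : ℂ)
            • tens (u.map (boxVec hν (I.s i.castSucc) (I.s i.succ)))) ^ 2
            ≤ δ * len (I.s i.castSucc) (I.s i.succ) * |C| := by
          intro i
          rw [qNorm_smul, mul_pow, qNorm_sq hq₁ hq₂, hC, Complex.norm_real, Real.norm_eq_abs,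
            sq_abs, ← mul_assoc, ← pow_mul, ← pow_add]
          refine (mul_le_mul_of_nonneg_left (le_abs_self C)
            (pow_nonneg (len_nonneg _ _) _)).trans (mul_le_mul_of_nonneg_right ?_ (abs_nonneg C))
          exact pow_le_mul_of_two_le (len_nonneg _ _) (hlen I hI i) (min_le_left _ _)
            (by rwa [mul_comm p])
        refine (Finset.sum_le_sum fun i _ => h1 i).trans_lt ?_
        rw [← Finset.sum_mul, ← Finset.mul_sum, I.sum_len]
        have h2 : δ * (t * |C| + 1) ≤ ε ^ 2 := by
          rw [← le_div_iff₀ (by positivity)]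
          exact min_le_right _ _
        nlinarith
      · intro i _ j _ hij
        simp only [← qForm_apply]
        rw [LinearMap.map_smul, LinearMap.map_smulₛₗ, LinearMap.smul_apply, qForm_apply,
          qInner_tens_boxVec_of_disjoint q hν (I.disjoint hij) hu, smul_zero, smul_zero]

/-- The single tensors and the vacuum terms sum exactly to the vacuum vector of `diag`, so the error
is the sum of the remainders. -/
theorem isDiagonalMeasure_diag {q t : ℝ} (hq₁ : -1 < q) (hq₂ : q < 1) (ht : 0 ≤ t)
    (hν : IsCompact ν.support) (k : ℕ) :
    IsDiagonalMeasure q hν (k + 1) t (diag q hν k t) := by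
  obtain ⟨R, hR, h⟩ := exists_X_pow_apply_one q hν k
  intro ε hε
  obtain ⟨δ, hδ, H⟩ := negligible_of_mem_higherOrder hq₁ hq₂ ht hν hR ε hε
  refine ⟨δ, hδ, fun I hI => ?_⟩
  have hlen : ∑ i : Fin I.N, ((len (I.s i.castSucc) (I.s i.succ) * cumulant ν k : ℝ) : ℂ)
      • (1 : Falg (OneParticle ν)) = ((t * cumulant ν k : ℝ) : ℂ) • 1 := by
    rw [← Finset.sum_smul, ← Complex.ofReal_sum, ← Finset.sum_mul, I.sum_len]
  have hbox : ∑ i : Fin I.N, tens [boxVec hν (I.s i.castSucc) (I.s i.succ) k]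
      = tens [boxVec hν 0 t k] := by
    simp only [tens, List.map_cons, List.map_nil, List.prod_cons, List.prod_nil, mul_one,
      ← map_sum, I.sum_boxVec]
  have : (∑ i : Fin I.N, X q hν (I.s i.castSucc) (I.s i.succ) ^ (k + 1) - diag q hν k t) 1
      = ∑ i : Fin I.N, R (I.s i.castSucc) (I.s i.succ) := by
    rw [LinearMap.sub_apply, LinearMap.sum_apply, diag_one]
    simp only [h, Finset.sum_add_distrib, hlen, hbox]
    abel
  rw [phiNorm_eq, this]
  exact H I hI

/-- Arbitrarily fine subdivisions exist, so the vacuum vectors agree by the triangle inequality and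
definiteness; the separating vacuum does the rest. -/
theorem IsDiagonalMeasure.unique {q t : ℝ} (hq₁ : -1 < q) (hq₂ : q < 1) (ht : 0 ≤ t)
    {hν : IsCompact ν.support} {k : ℕ} {D D' : Op ν} (hD : D ∈ algXΔ q hν)
    (hD' : D' ∈ algXΔ q hν) (h : IsDiagonalMeasure q hν k t D)
    (h' : IsDiagonalMeasure q hν k t D') : D = D' := by
  refine eq_of_apply_one_eq hD hD' (sub_eq_zero.1 (qNorm_eq_zero hq₁ hq₂ ?_))
  refine le_antisymm (le_of_forall_pos_le_add fun ε hε => ?_) (qNorm_nonneg _ _)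
  obtain ⟨δ, hδ, H⟩ := h (ε / 2) (half_pos hε)
  obtain ⟨δ', hδ', H'⟩ := h' (ε / 2) (half_pos hε)
  obtain ⟨I, hI⟩ := Subdivision.exists_lt ht (lt_min hδ hδ')
  have h1 := H I fun i => (hI i).trans_le (min_le_left _ _)
  have h2 := H' I fun i => (hI i).trans_le (min_le_right _ _)
  rw [phiNorm_eq, LinearMap.sub_apply] at h1 h2
  have h3 := qNorm_sub_le hq₁ hq₂
    ((∑ i : Fin I.N, X q hν (I.s i.castSucc) (I.s i.succ) ^ k) 1 - D' 1)
    ((∑ i : Fin I.N, X q hν (I.s i.castSucc) (I.s i.succ) ^ k) 1 - D 1)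
  rw [sub_sub_sub_cancel_left] at h3
  linarith

end Diagonal

/-! ### The full stochastic measures -/

section FullMeasures

variable {ν : Measure ℝ} [IsProbabilityMeasure ν]

/-- The tensor `χ_[0,t)^{⊗n}`. -/
noncomputable def cubeTens (hν : IsCompact ν.support) (t : ℝ) (n : ℕ) : Falg (OneParticle ν) :=
  tens ((List.replicate n 0).map (boxVec hν 0 t))

/-- The tensor `χ_[0,t) ⊗ x^k ⊗ χ_[0,t)^{⊗n} + r_(k+1) t χ_[0,t)^{⊗n}`. -/
noncomputable def diagTens (hν : IsCompact ν.support) (t : ℝ) (k n : ℕ) :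
    Falg (OneParticle ν) :=
  tens ((k :: List.replicate n 0).map (boxVec hν 0 t))
    + ((t * cumulant ν k : ℝ) : ℂ) • cubeTens hν t n

theorem diag_cubeTens_zero (q : ℝ) (hν : IsCompact ν.support) (t : ℝ) (k : ℕ) :
    diag q hν k t (cubeTens hν t 0) = diagTens hν t k 0 :=
  diag_one q hν k t

theorem diag_cubeTens_succ (q : ℝ) (hν : IsCompact ν.support) {t : ℝ} (ht : 0 ≤ t) (k n : ℕ) :
    diag q hν k t (cubeTens hν t (n + 1))
      = diagTens hν t k (n + 1) + ((qNum q (n + 1) : ℝ) : ℂ) • diagTens hν t (k + 1) n := by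
  have he : ∀ i : Fin (List.replicate (n + 1) 0).length,
      (List.replicate (n + 1) 0).eraseIdx i = List.replicate n 0 := by
    intro i
    have hi : (i : ℕ) < n + 1 := i.isLt.trans_eq List.length_replicate
    simp [List.eraseIdx_replicate, hi]
  have hs : ∑ i : Fin (List.replicate (n + 1) 0).length, q ^ (i : ℕ) = qNum q (n + 1) := by
    rw [Fin.sum_univ_eq_sum_range (fun i => q ^ i), List.length_replicate, qNum]
  have hlen : len 0 t = t := by rw [len_eq le_rfl ht, sub_zero]
  rw [diag, LinearMap.add_apply, cubeTens, Y_tens]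
  simp only [he, Fin.getElem_fin, List.getElem_replicate, ← Finset.sum_smul, ← Complex.ofReal_sum,
    ← Finset.sum_mul, hs, add_zero, hlen]
  rw [diagTens, diagTens, LinearMap.smul_apply, Module.End.one_apply, smul_add, smul_smul,
    ← Complex.ofReal_mul, cubeTens, cubeTens]
  abel

/-- By `diag_cubeTens_succ` each summand is a `diagTens` plus `[n-k]_q` times the next one, and the
coefficients satisfy `c (k + 1) = -c k * [n-k]_q`. The sum telescopes to its `k = 0` term, which is
the next cube since `cumulant ν 0 = 0`. -/
theorem sum_diag_cubeTens {q : ℝ} (hq₁ : -1 < q) (hq₂ : q < 1) (hν : IsCompact ν.support) {t : ℝ}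
    (ht : 0 ≤ t) (n : ℕ) :
    ∑ k ∈ Finset.range (n + 1), (((-1) ^ k * (qFact q n / qFact q (n - k)) : ℝ) : ℂ) •
      diag q hν k t (cubeTens hν t (n - k)) = cubeTens hν t (n + 1) := by
  let c : ℕ → ℝ := fun k => (-1) ^ k * (qFact q n / qFact q (n - k))
  have hstep : ∀ k ∈ Finset.range n, (c k : ℂ) • diag q hν k t (cubeTens hν t (n - k))
      = (c k : ℂ) • diagTens hν t k (n - k)
        - (c (k + 1) : ℂ) • diagTens hν t (k + 1) (n - (k + 1)) := by
    intro k hk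
    obtain ⟨m, rfl⟩ := Nat.exists_eq_add_of_lt (Finset.mem_range.1 hk)
    have h1 : k + m + 1 - k = m + 1 := by omega
    have h2 : k + m + 1 - (k + 1) = m := by omega
    have h3 : c (k + 1) = -(c k * qNum q (m + 1)) := by
      have e1 := (qFact_pos hq₁ hq₂ m).ne'
      have e2 := (qNum_pos hq₁ hq₂ (Nat.le_add_left 1 m)).ne'
      simp only [c, h1, h2, qFact_succ q m]
      field_simp
      ring
    rw [h1, h2, diag_cubeTens_succ q hν ht, smul_add, smul_smul, ← Complex.ofReal_mul, h3,
      Complex.ofReal_neg, neg_smul, sub_neg_eq_add]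
  rw [Finset.sum_range_succ, Finset.sum_congr rfl hstep,
    Finset.sum_range_sub' (fun k => (c k : ℂ) • diagTens hν t k (n - k))]
  change _ - (c n : ℂ) • diagTens hν t n (n - n)
    + (c n : ℂ) • diag q hν n t (cubeTens hν t (n - n)) = _
  rw [Nat.sub_self, diag_cubeTens_zero, sub_add_cancel]
  have h0 : c 0 = 1 := by simp [c, (qFact_pos hq₁ hq₂ n).ne']
  rw [h0, diagTens, Nat.sub_zero]
  simp [cumulant, cubeTens, List.replicate_succ]

/-- The Kailath–Segall formula itself is used as a recursive definition of the operators. -/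
theorem exists_mem_algXΔ_cubeTens {q : ℝ} (hq₁ : -1 < q) (hq₂ : q < 1) (hν : IsCompact ν.support)
    {t : ℝ} (ht : 0 ≤ t) (n : ℕ) : ∃ Z ∈ algXΔ q hν, Z 1 = cubeTens hν t n := by
  induction n using Nat.strong_induction_on with
  | _ n ih =>
    cases n with
    | zero => exact ⟨1, one_mem _, rfl⟩
    | succ n =>
      choose! Z hZ hZ1 using ih
      refine ⟨∑ k ∈ Finset.range (n + 1), (((-1) ^ k * (qFact q n / qFact q (n - k)) : ℝ) : ℂ) •
        (diag q hν k t * Z (n - k)), ?_, ?_⟩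
      · exact sum_mem fun k _ => Subalgebra.smul_mem _
          (mul_mem (diag_mem_algXΔ q hν k ht) (hZ _ (by omega))) _
      · rw [← sum_diag_cubeTens hq₁ hq₂ hν ht, LinearMap.sum_apply]
        refine Finset.sum_congr rfl fun k _ => ?_
        rw [LinearMap.smul_apply, Module.End.mul_apply, hZ1 _ (by omega)]

/-- Disjoint supports kill annihilation and gauge; only creation survives. -/
theorem X_apply_tens_of_disjoint (q : ℝ) (hν : IsCompact ν.support) {a b : ℝ} (l : List (ℝ × ℝ))
    (h : ∀ p ∈ l, Disjoint (Set.Ico a b) (Set.Ico p.1 p.2)) :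
    X q hν a b (tens (l.map fun p => boxVec hν p.1 p.2 0))
      = tens (boxVec hν a b 0 :: l.map fun p => boxVec hν p.1 p.2 0) := by
  have hd : ∀ i : Fin (l.map fun p => boxVec hν p.1 p.2 0).length,
      Disjoint (Set.Ico a b) (Set.Ico (l[(i : ℕ)]'(by simpa using i.isLt)).1
        (l[(i : ℕ)]'(by simpa using i.isLt)).2) := fun i => h _ (List.getElem_mem _)
  rw [X, Y, fieldOp, LinearMap.add_apply, LinearMap.add_apply, annihilation_tens, gauge_tens,
    Finset.sum_eq_zero, Finset.sum_eq_zero, zero_add, add_zero, creation, LinearMap.mulLeft_apply,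
    ← tens_cons]
  · intro i _
    simp only [Fin.getElem_fin, List.getElem_map, boxMul_boxVec_of_disjoint hν _ _ (hd i)]
    rw [tens_cons]
    simp
  · intro i _
    simp only [Fin.getElem_fin, List.getElem_map, inner_boxVec_of_disjoint hν _ _ (hd i), mul_zero,
      zero_smul]

theorem prod_X_apply_one (q : ℝ) (hν : IsCompact ν.support) (l : List (ℝ × ℝ))
    (h : l.Pairwise fun p p' => Disjoint (Set.Ico p.1 p.2) (Set.Ico p'.1 p'.2)) :
    (l.map fun p => X q hν p.1 p.2).prod 1 = tens (l.map fun p => boxVec hν p.1 p.2 0) := by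
  induction l with
  | nil => rfl
  | cons p l ih =>
    rw [List.pairwise_cons] at h
    rw [List.map_cons, List.prod_cons, Module.End.mul_apply, ih h.2,
      X_apply_tens_of_disjoint q hν l h.1, List.map_cons]

/-- The tensor `⊗ᵢ χ_[lo i, hi i)`. -/
noncomputable def rectTens (hν : IsCompact ν.support) {n : ℕ} (p : Fin n → ℝ × ℝ) :
    Falg (OneParticle ν) :=
  tens (List.ofFn fun i => boxVec hν (p i).1 (p i).2 0)

/-- The indicator function of `∏ᵢ [lo i, hi i)`. -/
noncomputable def rectFn {n : ℕ} (p : Fin n → ℝ × ℝ) : (Fin n → ℝ) → ℂ :=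
  (Set.univ.pi fun i => Set.Ico (p i).1 (p i).2).indicator 1

/-- The Lebesgue measure on `ℝ₊ⁿ`. -/
noncomputable abbrev orthantMeasure (n : ℕ) : Measure (Fin n → ℝ) :=
  Measure.pi fun _ => volume.restrict (Set.Ici (0 : ℝ))

theorem measurableSet_rect {n : ℕ} (p : Fin n → ℝ × ℝ) :
    MeasurableSet (Set.univ.pi fun i => Set.Ico (p i).1 (p i).2) :=
  MeasurableSet.univ_pi fun _ => measurableSet_Ico

theorem orthantMeasure_rect_ne_top {n : ℕ} (p : Fin n → ℝ × ℝ) :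
    orthantMeasure n (Set.univ.pi fun i => Set.Ico (p i).1 (p i).2) ≠ ⊤ := by
  rw [Measure.pi_pi]
  exact ENNReal.prod_ne_top fun i _ =>
    ((Measure.restrict_apply_le _ _).trans_lt (by simp)).ne

/-- The class of `rectFn p` in `L²`. -/
noncomputable def rectLp {n : ℕ} (p : Fin n → ℝ × ℝ) : Lp ℂ 2 (orthantMeasure n) :=
  indicatorConstLp 2 (measurableSet_rect p) (orthantMeasure_rect_ne_top p) 1

theorem inner_rectLp {n : ℕ} (p p' : Fin n → ℝ × ℝ) :
    inner ℂ (rectLp p) (rectLp p') = ((∏ i, (volume.restrict (Set.Ici (0 : ℝ))).real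
      (Set.Ico (p i).1 (p i).2 ∩ Set.Ico (p' i).1 (p' i).2) : ℝ) : ℂ) := by
  rw [rectLp, rectLp, L2.inner_indicatorConstLp_one_indicatorConstLp_one (measurableSet_rect p)
    (measurableSet_rect p') (orthantMeasure_rect_ne_top p) (orthantMeasure_rect_ne_top p'),
    ← Set.pi_inter_distrib, Measure.real, Measure.pi_pi, ENNReal.toReal_prod]
  rfl

/-- Since `ν` has mass one, both sides are the product of the lengths of the intersections. This is
the isometry behind the multiple integrals. -/
theorem inner₀_rectTens (hν : IsCompact ν.support) {n : ℕ} (p p' : Fin n → ℝ × ℝ) :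
    inner₀ (rectTens hν p) (rectTens hν p') = inner ℂ (rectLp p) (rectLp p') := by
  rw [inner_rectLp, rectTens, rectTens, inner₀_tens_ofFn, Complex.ofReal_prod]
  simp only [inner_boxVec, add_zero, pow_zero, integral_const, probReal_univ, smul_eq_mul, mul_one,
    Complex.ofReal_one]

theorem eLpNorm_linearCombination_rectFn {n : ℕ} (T : (Fin n → ℝ × ℝ) →₀ ℂ) :
    eLpNorm (Finsupp.linearCombination ℂ rectFn T) 2 (orthantMeasure n)
      = ENNReal.ofReal ‖Finsupp.linearCombination ℂ rectLp T‖ := by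
  have h : Finsupp.linearCombination ℂ rectLp T
      =ᵐ[orthantMeasure n] Finsupp.linearCombination ℂ rectFn T := by
    induction T using Finsupp.induction_linear with
    | zero => simpa using Lp.coeFn_zero ℂ 2 (orthantMeasure n)
    | add S T hS hT =>
      rw [map_add, map_add]
      exact (Lp.coeFn_add _ _).trans (hS.add hT)
    | single p c =>
      rw [Finsupp.linearCombination_single, Finsupp.linearCombination_single]
      exact (Lp.coeFn_smul _ _).trans
        ((indicatorConstLp_coeFn (hs := measurableSet_rect p)).const_smul c)
  rw [← eLpNorm_congr_ae h, ← Lp.enorm_def, ofReal_norm]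

theorem inner₀_linearCombination (hν : IsCompact ν.support) {n : ℕ}
    (T : (Fin n → ℝ × ℝ) →₀ ℂ) :
    (inner₀ (Finsupp.linearCombination ℂ (rectTens hν) T)
      (Finsupp.linearCombination ℂ (rectTens hν) T)).re
      = (eLpNorm (Finsupp.linearCombination ℂ rectFn T) 2 (orthantMeasure n)).toReal ^ 2 := by
  have h : inner₀ (Finsupp.linearCombination ℂ (rectTens hν) T)
      (Finsupp.linearCombination ℂ (rectTens hν) T)
      = inner ℂ (Finsupp.linearCombination ℂ rectLp T) (Finsupp.linearCombination ℂ rectLp T) := by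
    simp only [Finsupp.linearCombination_apply, Finsupp.sum, inner₀_sum_smul, sum_inner, inner_sum,
      inner_smul_left, inner_smul_right, inner₀_rectTens, Finset.mul_sum]
    rw [Finset.sum_comm]
    exact Finset.sum_congr rfl fun i _ => Finset.sum_congr rfl fun j _ => by ring
  rw [h, eLpNorm_linearCombination_rectFn, ENNReal.toReal_ofReal (norm_nonneg _)]
  exact inner_self_eq_norm_sq (𝕜 := ℂ) _

theorem qNorm_linearCombination_le {q : ℝ} (hq₁ : -1 < q) (hq₂ : q < 1) (hν : IsCompact ν.support)
    {n : ℕ} (T : (Fin n → ℝ × ℝ) →₀ ℂ) :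
    qNorm q (Finsupp.linearCombination ℂ (rectTens hν) T) ^ 2
      ≤ n.factorial
        * (eLpNorm (Finsupp.linearCombination ℂ rectFn T) 2 (orthantMeasure n)).toReal ^ 2 := by
  rw [qNorm_sq hq₁ hq₂, ← inner₀_linearCombination hν]
  refine qInner_re_le hq₁ hq₂ ?_
  rw [Finsupp.linearCombination_apply]
  exact Submodule.sum_mem _ fun p _ => Submodule.smul_mem _ _ (tens_ofFn_mem _)

theorem simpleFn_eq {n : ℕ} (S : Rect n →₀ ℂ) :
    simpleFn S = Finsupp.linearCombination ℂ rectFn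
      (S.mapDomain fun R i => (R.lo i, R.hi i)) := by
  rw [Finsupp.linearCombination_mapDomain, Finsupp.linearCombination_apply]
  funext y
  rw [simpleFn, Finsupp.sum, Finsupp.sum, Finset.sum_apply]
  rfl

theorem simpleIntegral_apply_one (q : ℝ) (hν : IsCompact ν.support) {n : ℕ} (S : Rect n →₀ ℂ) :
    simpleIntegral q hν S 1 = Finsupp.linearCombination ℂ (rectTens hν)
      (S.mapDomain fun R i => (R.lo i, R.hi i)) := by
  rw [Finsupp.linearCombination_mapDomain, Finsupp.linearCombination_apply, simpleIntegral,
    Finsupp.sum, Finsupp.sum, LinearMap.sum_apply]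
  refine Finset.sum_congr rfl fun R _ => ?_
  rw [LinearMap.smul_apply]
  congr 1
  have h := prod_X_apply_one q hν (List.ofFn fun i => (R.lo i, R.hi i))
    (List.pairwise_ofFn.2 fun i j hij => R.disjoint hij.ne)
  rw [List.map_ofFn, List.map_ofFn] at h
  exact h

theorem cubeTens_eq (hν : IsCompact ν.support) (t : ℝ) (n : ℕ) :
    cubeTens hν t n = rectTens hν fun _ : Fin n => (0, t) := by
  rw [cubeTens, rectTens, List.ofFn_const, List.map_replicate]

theorem isFullStochasticMeasure_of_apply_one {q : ℝ} (hq₁ : -1 < q) (hq₂ : q < 1)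
    {hν : IsCompact ν.support} {t : ℝ} {n : ℕ} {Z : Op ν} (hZ : Z 1 = cubeTens hν t n) :
    IsFullStochasticMeasure q hν n t Z := by
  intro ε hε
  have hf : (0 : ℝ) < n.factorial := by exact_mod_cast n.factorial_pos
  -- The factor `√n!` compensates the bound of the `q`-norm by the `L²` norm. The target cube is not
  -- a `Rect` for `n ≥ 2`, as its sides are not disjoint, so the difference `T` below lives on
  -- arbitrary boxes.
  refine ⟨ENNReal.ofReal (ε / √n.factorial), by simp; positivity, fun S hS => ?_⟩
  let T : (Fin n → ℝ × ℝ) →₀ ℂ :=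
    S.mapDomain (fun R i => (R.lo i, R.hi i)) - Finsupp.single (fun _ => (0, t)) 1
  have hT : simpleFn S - (Set.univ.pi fun _ : Fin n => Set.Ico 0 t).indicator 1
      = Finsupp.linearCombination ℂ rectFn T := by
    rw [map_sub, ← simpleFn_eq, Finsupp.linearCombination_single, one_smul]
    rfl
  have hT' : (simpleIntegral q hν S - Z) 1 = Finsupp.linearCombination ℂ (rectTens hν) T := by
    rw [map_sub, LinearMap.sub_apply, simpleIntegral_apply_one, Finsupp.linearCombination_single,
      one_smul, hZ, cubeTens_eq]
  rw [hT] at hS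
  rw [phiNorm_eq, hT']
  refine lt_of_pow_lt_pow_left₀ 2 hε.le
    ((qNorm_linearCombination_le hq₁ hq₂ hν T).trans_lt ?_)
  have h1 := (ENNReal.toReal_lt_toReal hS.ne_top ENNReal.ofReal_ne_top).2 hS
  rw [ENNReal.toReal_ofReal (by positivity)] at h1
  calc _ < (n.factorial : ℝ) * (ε / √n.factorial) ^ 2 :=
        mul_lt_mul_of_pos_left (pow_lt_pow_left₀ h1 ENNReal.toReal_nonneg two_ne_zero) hf
    _ = ε ^ 2 := by
        rw [div_pow, Real.sq_sqrt hf.le]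
        field_simp

end FullMeasures

/-! ### Approximation of the cube indicator by off-diagonal simple functions -/

section Density

theorem rectFn_apply {n : ℕ} (p : Fin n → ℝ × ℝ) (y : Fin n → ℝ) :
    rectFn p y = ∏ i, (Set.Ico (p i).1 (p i).2).indicator (1 : ℝ → ℂ) (y i) := by
  classical
  simp only [rectFn, Set.indicator_apply, Pi.one_apply, Finset.prod_ite_zero, Finset.prod_const_one,
    Set.mem_univ_pi, Finset.mem_univ, true_implies]

/-- The product of the intervals with indices `f i` of a subdivision. -/
def Subdivision.cell {t : ℝ} (I : Subdivision t) {n : ℕ} (f : Fin n → Fin I.N) :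
    Fin n → ℝ × ℝ :=
  fun i => (I.s (f i).castSucc, I.s (f i).succ)

theorem Subdivision.sum_rectFn_cell {t : ℝ} (I : Subdivision t) (n : ℕ) :
    ∑ f : Fin n → Fin I.N, rectFn (I.cell f) = rectFn fun _ : Fin n => (0, t) := by
  have h1 : ∀ x : ℝ, ∑ j : Fin I.N,
      (Set.Ico (I.s j.castSucc) (I.s j.succ)).indicator (1 : ℝ → ℂ) x
        = (Set.Ico 0 t).indicator 1 x := by
    intro x
    have h2 := I.sum_sub fun b => (Set.Ico 0 b).indicator (1 : ℝ → ℂ) x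
    rw [Set.Ico_self, Set.indicator_empty, sub_zero] at h2
    rw [← h2]
    refine Finset.sum_congr rfl fun j _ => ?_
    rw [eq_sub_iff_add_eq', ← Set.Ico_union_Ico_eq_Ico (I.nonneg j.castSucc) (I.lt j).le,
      Set.indicator_union_of_disjoint Set.Ico_disjoint_Ico_same]
  funext y
  rw [Finset.sum_apply, rectFn_apply, ← Finset.prod_congr rfl fun i _ => h1 (y i),
    Finset.prod_univ_sum, Fintype.piFinset_univ]
  exact Finset.sum_congr rfl fun f _ => rectFn_apply _ _

/-- The cells off the diagonals. -/
def Subdivision.rect {t : ℝ} (I : Subdivision t) {n : ℕ} (f : Fin n ↪ Fin I.N) : Rect n where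
  lo i := I.s (f i).castSucc
  hi i := I.s (f i).succ
  nonneg _ := I.nonneg _
  lt _ := I.lt _
  disjoint _ _ hij := I.disjoint (f.injective.ne hij)

open scoped Classical in
-- The cells of the grid tile the cube; those with pairwise distinct indices are admissible
-- rectangles, and the others are the error.
theorem Subdivision.simpleFn_sub {t : ℝ} (I : Subdivision t) (n : ℕ) :
    simpleFn (∑ f : Fin n ↪ Fin I.N, Finsupp.single (I.rect f) 1) - rectFn (fun _ => (0, t))
      = Finsupp.linearCombination ℂ rectFn
          (-∑ f : Fin n → Fin I.N with ¬ Function.Injective f, Finsupp.single (I.cell f) 1) := by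
  have h1 : simpleFn (∑ f : Fin n ↪ Fin I.N, Finsupp.single (I.rect f) 1)
      = ∑ f : Fin n → Fin I.N with Function.Injective f, rectFn (I.cell f) := by
    rw [simpleFn_eq, Finsupp.linearCombination_mapDomain, map_sum]
    simp only [Finsupp.linearCombination_single, one_smul]
    refine Finset.sum_bij (fun f _ => f) (fun f _ => ?_) (fun f _ g _ h => DFunLike.coe_injective h)
      (fun f hf => ⟨⟨f, (Finset.mem_filter.1 hf).2⟩, Finset.mem_univ _, rfl⟩) (fun f _ => rfl)
    exact Finset.mem_filter.2 ⟨Finset.mem_univ _, f.injective⟩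
  rw [h1, ← I.sum_rectFn_cell, ← Finset.sum_filter_add_sum_filter_not Finset.univ
    (fun f : Fin n → Fin I.N => Function.Injective f), map_neg, map_sum]
  simp only [Finsupp.linearCombination_single, one_smul]
  abel

/-- There are at least `(N + 1 - n) ^ n` injections, and Bernoulli's inequality bounds this below by
`N ^ n * (1 - n * (n - 1) / N)`. -/
theorem card_not_injective_le {n N : ℕ} (hn : n ≤ N) (hN : 0 < N) [DecidablePred
    (Function.Injective : (Fin n → Fin N) → Prop)] :
    ((Finset.univ.filter fun f : Fin n → Fin N => ¬ Function.Injective f).card : ℝ)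
      ≤ (N : ℝ) ^ n * (n ^ 2 / N) := by
  have hN' : (0 : ℝ) < N := by exact_mod_cast hN
  have h1 : (Finset.univ.filter fun f : Fin n → Fin N => Function.Injective f).card
      = N.descFactorial n := by
    rw [← Fintype.card_subtype, Fintype.card_congr (Equiv.subtypeInjectiveEquivEmbedding _ _),
      Fintype.card_embedding_eq, Fintype.card_fin, Fintype.card_fin]
  have h2 := Finset.card_filter_add_card_filter_not (s := Finset.univ)
    (fun f : Fin n → Fin N => Function.Injective f)
  rw [h1, Finset.card_univ, Fintype.card_fun, Fintype.card_fin, Fintype.card_fin] at h2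
  have h3 : ((N : ℝ) + 1 - n) ^ n ≤ N.descFactorial n := by
    have := Nat.pow_sub_le_descFactorial N n
    have h4 : ((N + 1 - n : ℕ) : ℝ) = (N : ℝ) + 1 - n := by
      rw [Nat.cast_sub (by omega)]
      push_cast
      ring
    rw [← h4]
    exact_mod_cast this
  have h5 : (N : ℝ) + 1 - n = N * (1 + (1 - n) / N) := by
    field_simp
    ring
  have h6 : 1 + n * ((1 - n : ℝ) / N) ≤ (1 + (1 - n) / N) ^ n := by
    refine one_add_mul_le_pow ?_ n
    rw [le_div_iff₀ hN']
    have : (n : ℝ) ≤ N := by exact_mod_cast hn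
    linarith
  rw [h5, mul_pow] at h3
  have h7 := mul_le_mul_of_nonneg_left h6 (pow_nonneg hN'.le n)
  have h8 : (N.descFactorial n : ℝ)
      + (Finset.univ.filter fun f : Fin n → Fin N => ¬ Function.Injective f).card
      = (N : ℝ) ^ n := by exact_mod_cast h2
  have h9 : (N : ℝ) ^ n * (n ^ 2 / N) = N ^ n - N ^ n * (1 + n * ((1 - n) / N)) + N ^ n * (n / N) := by
    field_simp
    ring
  have h10 : 0 ≤ (N : ℝ) ^ n * (n / N) := by positivity
  linarith

theorem exists_simpleFn_close {t : ℝ} (ht : 0 ≤ t) (n : ℕ) {ε : ℝ} (hε : 0 < ε) :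
    ∃ S : Rect n →₀ ℂ, eLpNorm (simpleFn S - rectFn fun _ => (0, t)) 2 (orthantMeasure n)
      < ENNReal.ofReal ε := by
  classical
  have hε' : 0 < ENNReal.ofReal ε := ENNReal.ofReal_pos.2 hε
  rcases ht.eq_or_lt with rfl | ht
  -- For `t = 0` the cube is empty unless `n = 0`, when it is a point and the empty product of
  -- intervals represents it exactly.
  · rcases Nat.eq_zero_or_pos n with rfl | hn
    · let R : Rect 0 := ⟨Fin.elim0, Fin.elim0, fun i => i.elim0, fun i => i.elim0, fun i => i.elim0⟩
      refine ⟨Finsupp.single R 1, ?_⟩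
      have : simpleFn (Finsupp.single R 1) - rectFn (fun _ => (0, 0)) = 0 := by
        funext y
        simp [simpleFn, Rect.fn, rectFn]
      rwa [this, eLpNorm_zero]
    · refine ⟨0, ?_⟩
      have : simpleFn (0 : Rect n →₀ ℂ) - rectFn (fun _ => (0, 0)) = 0 := by
        have : NeZero n := ⟨hn.ne'⟩
        funext y
        rw [Pi.sub_apply, rectFn_apply, Finset.prod_eq_zero (Finset.mem_univ 0) (by simp)]
        simp [simpleFn]
      rwa [this, eLpNorm_zero]
  -- The cells are orthogonal with squared norm `(t / N) ^ n`, so the squared error is at most `t ^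
  -- n * n ^ 2 / N`, which this `N` makes less than `ε ^ 2`.
  · obtain ⟨N, hN⟩ := exists_nat_gt (max n (t ^ n * n ^ 2 / ε ^ 2) : ℝ)
    have hnN : n ≤ N := by exact_mod_cast ((le_max_left _ _).trans_lt hN).le
    have hN' : (0 : ℝ) < N := ((Nat.cast_nonneg n).trans (le_max_left _ _)).trans_lt hN
    have hN0 : 0 < N := by exact_mod_cast hN'
    let I := Subdivision.uniform ht N hN0
    have hI : ∀ i : Fin I.N, len (I.s i.castSucc) (I.s i.succ) = t / N := by
      intro i
      rw [len_eq (I.nonneg _) (I.lt i).le]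
      change (((i : ℕ) + 1 : ℕ) : ℝ) * (t / N) - ((i : ℕ) : ℝ) * (t / N) = t / N
      push_cast
      ring
    refine ⟨∑ f : Fin n ↪ Fin I.N, Finsupp.single (I.rect f) 1, ?_⟩
    rw [I.simpleFn_sub, eLpNorm_linearCombination_rectFn, ENNReal.ofReal_lt_ofReal_iff hε, map_neg,
      norm_neg, map_sum]
    simp only [Finsupp.linearCombination_single, one_smul]
    refine lt_of_pow_lt_pow_left₀ 2 hε.le ?_
    have hinner : ∀ f g : Fin n → Fin I.N, inner ℂ (rectLp (I.cell f)) (rectLp (I.cell g))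
        = if f = g then (((t / N) ^ n : ℝ) : ℂ) else 0 := by
      intro f g
      rw [inner_rectLp]
      split_ifs with h
      · subst h
        congr 1
        simp only [Set.inter_self]
        refine (Finset.prod_congr rfl fun i _ => hI (f i)).trans ?_
        rw [Finset.prod_const, Finset.card_univ, Fintype.card_fin]
      · obtain ⟨i, hi⟩ := Function.ne_iff.1 h
        rw [Finset.prod_eq_zero (Finset.mem_univ i), Complex.ofReal_zero]
        simp only [Subdivision.cell, Set.disjoint_iff_inter_eq_empty.1 (I.disjoint hi),
          measureReal_empty]
    rw [← inner_self_eq_norm_sq (𝕜 := ℂ), sum_inner]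
    simp only [inner_sum, hinner]
    have hcard := card_not_injective_le hnN hN0
    have h1 : ∑ f : Fin n → Fin I.N with ¬ Function.Injective f,
        ∑ g : Fin n → Fin I.N with ¬ Function.Injective g,
          (if f = g then (((t / N) ^ n : ℝ) : ℂ) else 0)
        = (((Finset.univ.filter fun f : Fin n → Fin I.N => ¬ Function.Injective f).card
          * (t / N) ^ n : ℝ) : ℂ) := by
      rw [Finset.sum_congr rfl fun f hf => by rw [Finset.sum_ite_eq, if_pos hf], Finset.sum_const]
      push_cast
      rw [nsmul_eq_mul]
    rw [h1]
    refine (Complex.ofReal_re _).trans_lt ?_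
    calc ((Finset.univ.filter fun f : Fin n → Fin I.N => ¬ Function.Injective f).card
          * (t / N) ^ n : ℝ) ≤ (N : ℝ) ^ n * (n ^ 2 / N) * (t / N) ^ n :=
          mul_le_mul_of_nonneg_right hcard (by positivity)
      _ = t ^ n * n ^ 2 / N := by
          rw [div_pow]
          field_simp
      _ < ε ^ 2 := by
          rw [div_lt_iff₀ hN', mul_comm (ε ^ 2), ← div_lt_iff₀ (by positivity)]
          exact (le_max_right _ _).trans_lt hN

end Density

/-! ### Uniqueness of the full stochastic measures and their recursion -/

section Uniqueness

variable {ν : Measure ℝ} [IsProbabilityMeasure ν]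

theorem IsFullStochasticMeasure.unique {q t : ℝ} (hq₁ : -1 < q) (hq₂ : q < 1) (ht : 0 ≤ t)
    {hν : IsCompact ν.support} {n : ℕ} {Z Z' : Op ν} (hZ : Z ∈ algXΔ q hν)
    (hZ' : Z' ∈ algXΔ q hν) (h : IsFullStochasticMeasure q hν n t Z)
    (h' : IsFullStochasticMeasure q hν n t Z') : Z = Z' := by
  refine eq_of_apply_one_eq hZ hZ' (sub_eq_zero.1 (qNorm_eq_zero hq₁ hq₂ ?_))
  refine le_antisymm (le_of_forall_pos_le_add fun ε hε => ?_) (qNorm_nonneg _ _)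
  obtain ⟨δ, hδ, H⟩ := h (ε / 2) (half_pos hε)
  obtain ⟨δ', hδ', H'⟩ := h' (ε / 2) (half_pos hε)
  -- The tolerances are extended reals and may be infinite; a finite positive one below both is
  -- needed for the density lemma.
  obtain ⟨r, hr0, hr⟩ := ENNReal.lt_iff_exists_nnreal_btwn.1 (lt_min hδ hδ')
  obtain ⟨S, hS⟩ := exists_simpleFn_close ht n (NNReal.coe_pos.2 (ENNReal.coe_pos.1 hr0))
  rw [ENNReal.ofReal_coe_nnreal] at hS
  have h1 := H S (hS.trans (hr.trans_le (min_le_left _ _)))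
  have h2 := H' S (hS.trans (hr.trans_le (min_le_right _ _)))
  rw [phiNorm_eq, LinearMap.sub_apply] at h1 h2
  have h3 := qNorm_sub_le hq₁ hq₂ (simpleIntegral q hν S 1 - Z' 1) (simpleIntegral q hν S 1 - Z 1)
  rw [sub_sub_sub_cancel_left] at h3
  linarith

/-- The Kailath–Segall formula for the full stochastic measures. -/
theorem fullStochasticMeasure_succ {q t : ℝ} (hq₁ : -1 < q) (hq₂ : q < 1) (ht : 0 ≤ t)
    {hν : IsCompact ν.support} {Δ ψ : ℕ → Op ν}
    (hΔ : ∀ k : ℕ, 1 ≤ k → Δ k ∈ algXΔ q hν ∧ IsDiagonalMeasure q hν k t (Δ k))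
    (hψ : ∀ n : ℕ, ψ n ∈ algXΔ q hν ∧ IsFullStochasticMeasure q hν n t (ψ n)) (n : ℕ) :
    ψ (n + 1) = ∑ k ∈ Finset.range (n + 1),
      (((-1) ^ k * (qFact q n / qFact q (n - k)) : ℝ) : ℂ) • (Δ (k + 1) * ψ (n - k)) := by
  have hΔ' : ∀ k, Δ (k + 1) = diag q hν k t := fun k =>
    (hΔ (k + 1) (Nat.le_add_left 1 k)).2.unique hq₁ hq₂ ht (hΔ (k + 1) (Nat.le_add_left 1 k)).1
      (diag_mem_algXΔ q hν k ht) (isDiagonalMeasure_diag hq₁ hq₂ ht hν k)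
  have hψ' : ∀ n, ψ n 1 = cubeTens hν t n := by
    intro n
    obtain ⟨Z, hZ, hZ1⟩ := exists_mem_algXΔ_cubeTens hq₁ hq₂ hν ht n
    rw [(hψ n).2.unique hq₁ hq₂ ht (hψ n).1 hZ (isFullStochasticMeasure_of_apply_one hq₁ hq₂ hZ1),
      hZ1]
  refine eq_of_apply_one_eq (hψ _).1 (sum_mem fun k _ => Subalgebra.smul_mem _
    (mul_mem (hΔ _ (Nat.le_add_left 1 k)).1 (hψ _).1) _) ?_
  rw [hψ', ← sum_diag_cubeTens hq₁ hq₂ hν ht, LinearMap.sum_apply]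
  refine Finset.sum_congr rfl fun k _ => ?_
  rw [LinearMap.smul_apply, Module.End.mul_apply, hψ', hΔ']

end Uniqueness

end QLevy

open QLevy
theorem mainTheorem8 (q : ℝ) (hq₁ : -1 < q) (hq₂ : q < 1) :
    (∀ (r : ℕ → ℝ) (j n : ℕ), 1 ≤ j →
      kailathSegall q r (j :: List.replicate n 1)
        = ksVar j * kailathSegall q r (List.replicate n 1)
          + ∑ k ∈ Finset.Icc 1 n, ((-1) ^ k * (qFact q n / qFact q (n - k))) •
              ((ksVar (j + k) + algebraMap ℝ _ (r (j + k)))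
                * kailathSegall q r (List.replicate (n - k) 1))) ∧
    (∀ (r : ℕ → ℝ) (n : ℕ), r 1 = 0 →
      kailathSegall q r (List.replicate (n + 1) 1)
        = ∑ k ∈ Finset.range (n + 1), ((-1) ^ k * (qFact q n / qFact q (n - k))) •
              ((ksVar (k + 1) + algebraMap ℝ _ (r (k + 1)))
                * kailathSegall q r (List.replicate (n - k) 1))) ∧
    (∀ (ν : MeasureTheory.Measure ℝ) [MeasureTheory.IsProbabilityMeasure ν]
        (hν : IsCompact ν.support) (t : ℝ), 0 ≤ t →
      (∀ k : ℕ, 1 ≤ k → ∃! D : Op ν, D ∈ algXΔ q hν ∧ IsDiagonalMeasure q hν k t D) ∧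
      (∀ n : ℕ, ∃! Z : Op ν, Z ∈ algXΔ q hν ∧ IsFullStochasticMeasure q hν n t Z) ∧
      (∀ Δ ψ : ℕ → Op ν,
        (∀ k : ℕ, 1 ≤ k → Δ k ∈ algXΔ q hν ∧ IsDiagonalMeasure q hν k t (Δ k)) →
        (∀ n : ℕ, ψ n ∈ algXΔ q hν ∧ IsFullStochasticMeasure q hν n t (ψ n)) →
        ∀ n : ℕ,
          ψ (n + 1) = ∑ k ∈ Finset.range (n + 1),
            (((-1) ^ k * (qFact q n / qFact q (n - k)) : ℝ) : ℂ) • (Δ (k + 1) * ψ (n - k)))) := by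
  refine ⟨fun r j n _ => kailathSegall_cons_ones hq₁ hq₂ r j n,
    fun r n hr => kailathSegall_ones hq₁ hq₂ r n hr, fun ν _ hν t ht => ⟨?_, ?_, ?_⟩⟩
  · intro k hk
    obtain ⟨k, rfl⟩ := Nat.exists_eq_add_of_le' hk
    have hD := diag_mem_algXΔ q hν k ht
    have hD' := isDiagonalMeasure_diag hq₁ hq₂ ht hν k
    exact ⟨diag q hν k t, ⟨hD, hD'⟩, fun D h => h.2.unique hq₁ hq₂ ht h.1 hD hD'⟩
  · intro n
    obtain ⟨Z, hZ, hZ1⟩ := exists_mem_algXΔ_cubeTens hq₁ hq₂ hν ht n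
    have hZ' := isFullStochasticMeasure_of_apply_one hq₁ hq₂ hZ1
    exact ⟨Z, ⟨hZ, hZ'⟩, fun W h => h.2.unique hq₁ hq₂ ht h.1 hZ hZ'⟩
  · exact fun Δ ψ hΔ hψ n => fullStochasticMeasure_succ hq₁ hq₂ ht hΔ hψ n
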